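/- Let $n\ge 1$ and let $(a_i)_i$, $(b_j)_j$ be finite families of nonzero homogeneous polynomials in $\mathbb{C}[x_1,\dots,x_n]$. Let $\nu_i,\rho_j\in\mathbb{C}$ with $\operatorname{Re}\nu_i,\operatorname{Re}\rho_j\ge 0$ and $\sum_i\nu_i\deg a_i=\sum_j\rho_j\deg b_j$. Write $p^{\mathrm{tr}}(x)=\max_{\ell\in\operatorname{supp}p}x^\ell$, let $\mathrm{NP}_p$ be the Newton polytope of $p$, and let $\mathcal A=\sum_i(\operatorname{Re}\nu_i)\mathrm{NP}_{a_i}$, $\mathcal B=\sum_j(\operatorname{Re}\rho_j)\mathrm{NP}_{b_j}$ (weighted Minkowski sums). Assume that $\mathcal B$ is $(n-1)$-dimensional and that $\mathcal A$ is contained in the relative interior of $\mathcal B$. On the positive projective simplex $\mathbb{P}^{n-1}_{>0}=\{[x_1:\dots:x_n]: x_k>0\}$ let $\Omega=\sum_{k=1}^n(-1)^{n-k}\frac{dx_1}{x_1}\wedge\dots\wedge\widehat{\frac{dx_k}{x_k}}\wedge\dots\wedge\frac{dx_n}{x_n}$, and put $$I^{\mathrm{tr}}=\int_{\mathbb{P}^{n-1}_{>0}}\frac{\prod_i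 a_i^{\mathrm{tr}}(x)^{\operatorname{Re}\nu_i}}{\prod_j b_j^{\mathrm{tr}}(x)^{\operatorname{Re}\rho_j}}\,\Omega,\qquad \mu^{\mathrm{tr}}=\frac1{I^{\mathrm{tr}}}\frac{\prod_i a_i^{\mathrm{tr}}(x)^{\operatorname{Re}\nu_i}}{\prod_j b_j^{\mathrm{tr}}(x)^{\operatorname{Re}\rho_j}}\,\Omega .$$ Let $\mathcal F$ be a simplicial refinement (a finite fan of simplicial cones, such that every cone of the refined fan is a union of cones of $\mathcal F$) of the image in $\mathbb{R}^n/\mathbb{R}\mathbf 1$, $\mathbf 1=(1,\dots,1)$, of the common refinement of the normal fans of $\mathcal A$ and $\mathcal B$, and let $\mathcal M$ be the set of its cones of maximal dimension. For each $\mathcal C\in\mathcal M$ choose vectors $u^{(\mathcal C,1)},\dots,u^{(\mathcal C,n-1)}\in\mathbb{R}^n$ whose classes generate the cone $\mathcal C$, and $w^{(\mathcal C)}=w_{\mathcal B}-w_{\mathcal A}$ with $w_{\mathcal A}\in\mathcal A$, $w_{\mathcal B}\in\mathcal B$ such that every functional $y$ with class in $\mathcal C$ attains its maximum over $\mathcal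 A$ at $w_{\mathcal A}$ and its maximum over $\mathcal B$ at $w_{\mathcal B}$. Put $$I^{\mathrm{tr}}_{\mathcal C}=\frac{|\det(u^{(\mathcal C,1)},\dots,u^{(\mathcal C,n-1)},\mathbf 1)|}{\prod_{k=1}^{n-1}\langle u^{(\mathcal C,k)},w^{(\mathcal C)}\rangle},\qquad x^{(\mathcal C)}_k(\xi)=\prod_{i=1}^{n-1}\xi_i^{-u^{(\mathcal C,i)}_k/\langle u^{(\mathcal C,i)},w^{(\mathcal C)}\rangle}\quad(1\le k\le n).$$ Then $I^{\mathrm{tr}}$ is a convergent integral with $0<I^{\mathrm{tr}}<\infty$, $\mu^{\mathrm{tr}}$ is a probability measure, and $I^{\mathrm{tr}}_{\mathcal C}>0$ for all $\mathcal C\in\mathcal M$ with $\sum_{\mathcal C\in\mathcal M}I^{\mathrm{tr}}_{\mathcal C}=I^{\mathrm{tr}}$. If a random cone $\mathcal C\in\mathcal M$ is drawn with probability $I^{\mathrm{tr}}_{\mathcal C}/I^{\mathrm{tr}}$ and, independently, $\xi$ is drawn uniformly from $[0,1]^{n-1}$, then the point $x=[x^{(\mathcal C)}_1(\xi):\dots:x^{(\mathcal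 C)}_n(\xi)]\in\mathbb{P}^{n-1}_{>0}$ lies almost surely in $\operatorname{Exp}\mathcal C$, where $\operatorname{Exp}\mathcal C=\{[e^{y_1}:\dots:e^{y_n}]: y+\mathbb{R}\mathbf 1\in\mathcal C\}$, and its distribution is $\mu^{\mathrm{tr}}$. -/

import Mathlib

open MeasureTheory ProbabilityTheory
open scoped Pointwise

noncomputable section

namespace TropicalSampling

/-! ### Polynomials, Newton polytopes, normal fans -/

/-- The exponent vector of a monomial, as a vector of real numbers. -/
def exponentVec {n : ℕ} (l : Fin n →₀ ℕ) : Fin n → ℝ := fun k => (l k : ℝ)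

/-- The Newton polytope of a polynomial: the convex hull of its support. -/
def newtonPolytope {n : ℕ} (p : MvPolynomial (Fin n) ℂ) : Set (Fin n → ℝ) :=
  convexHull ℝ (exponentVec '' (p.support : Set (Fin n →₀ ℕ)))

/-- The weighted Minkowski sum `∑ i, Re (ν i) • NP (p i)`. -/
def weightedPolytope {n : ℕ} {ι : Type*} [Fintype ι]
    (p : ι → MvPolynomial (Fin n) ℂ) (ν : ι → ℂ) : Set (Fin n → ℝ) :=
  ∑ i, (ν i).re • newtonPolytope (p i)

/-- The tropical approximation `p^tr(x) = max_{l ∈ supp p} x^l` (for `p ≠ 0`). -/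
def tropApprox {n : ℕ} (p : MvPolynomial (Fin n) ℂ) (x : Fin n → ℝ) : ℝ :=
  ⨆ l : p.support, ∏ k, x k ^ (l : Fin n →₀ ℕ) k

/-- The tropical integrand `∏ a_i^tr(x)^{Re ν_i} / ∏ b_j^tr(x)^{Re ρ_j}` on vectors. -/
def tropIntegrand {n : ℕ} {ι κ : Type*} [Fintype ι] [Fintype κ]
    (a : ι → MvPolynomial (Fin n) ℂ) (b : κ → MvPolynomial (Fin n) ℂ)
    (ν : ι → ℂ) (ρ : κ → ℂ) (x : Fin n → ℝ) : ℝ :=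
  (∏ i, tropApprox (a i) x ^ (ν i).re) / ∏ j, tropApprox (b j) x ^ (ρ j).re

/-- The normal cone of a subset `F` of `P`: all functionals that attain their maximum over `P`
at every point of `F`. -/
def normalCone {n : ℕ} (P F : Set (Fin n → ℝ)) : PointedCone ℝ (Fin n → ℝ) :=
  PointedCone.ofConeComb {y | ∀ v ∈ F, ∀ w ∈ P, y ⬝ᵥ w ≤ y ⬝ᵥ v} ⟨0, by simp⟩ (by
    intro x hx y hy s hs t ht v hv w hw
    simp only [add_dotProduct, smul_dotProduct, smul_eq_mul]
    exact add_le_add (mul_le_mul_of_nonneg_left (hx v hv w hw) hs)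
      (mul_le_mul_of_nonneg_left (hy v hv w hw) ht))

/-- The normal fan of a polytope: the normal cones of its nonempty faces, where a face is the set
of maximizers of a linear functional. -/
def normalFan {n : ℕ} (P : Set (Fin n → ℝ)) : Set (PointedCone ℝ (Fin n → ℝ)) :=
  {C | ∃ F : Set (Fin n → ℝ), F.Nonempty ∧ IsExposed ℝ P F ∧ C = normalCone P F}

/-- The common refinement of two fans: all pairwise intersections of their cones. -/
def commonRefinement {E : Type*} [AddCommGroup E] [Module ℝ E]
    (F G : Set (PointedCone ℝ E)) : Set (PointedCone ℝ E) :=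
  {C | ∃ C₁ ∈ F, ∃ C₂ ∈ G, C = C₁ ⊓ C₂}

/-- The tropical projective space `ℝⁿ / 𝟙ℝ`, with `n = m + 1`. -/
abbrev TropSpace (m : ℕ) : Type :=
  (Fin (m + 1) → ℝ) ⧸ (Submodule.span ℝ {(1 : Fin (m + 1) → ℝ)})

/-- The projection `ℝⁿ → ℝⁿ / 𝟙ℝ`. -/
abbrev toTrop (m : ℕ) : (Fin (m + 1) → ℝ) →ₗ[ℝ] TropSpace m :=
  Submodule.mkQ (Submodule.span ℝ {(1 : Fin (m + 1) → ℝ)})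

/-- The reduced common refinement of the normal fans of `A` and `B`: the images in `ℝⁿ / 𝟙ℝ` of
the cones of the common refinement. -/
def reducedCommonFan {m : ℕ} (A B : Set (Fin (m + 1) → ℝ)) :
    Set (PointedCone ℝ (TropSpace m)) :=
  PointedCone.map (toTrop m) '' commonRefinement (normalFan A) (normalFan B)

/-- A (finite, polyhedral) fan. -/
structure IsFan {E : Type*} [AddCommGroup E] [Module ℝ E]
    (F : Set (PointedCone ℝ E)) : Prop where
  finite : F.Finite
  polyhedral : ∀ C ∈ F, C.FG
  face_mem : ∀ C ∈ F, ∀ D : PointedCone ℝ E, D.IsFaceOf C → D ∈ F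
  inter_face : ∀ C ∈ F, ∀ D ∈ F, (C ⊓ D).IsFaceOf C ∧ (C ⊓ D).IsFaceOf D

/-- `F'` refines `F` if every cone of `F` is a union of cones of `F'`. -/
def Refines {E : Type*} [AddCommGroup E] [Module ℝ E] (F' F : Set (PointedCone ℝ E)) : Prop :=
  ∀ C ∈ F, ∃ S ⊆ F', (C : Set E) = ⋃ D ∈ S, (D : Set E)

/-- `F'` is a fan of simplicial cones that refines `F`. -/
structure IsSimplicialRefinement {E : Type*} [AddCommGroup E] [Module ℝ E]
    (F' F : Set (PointedCone ℝ E)) : Prop where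
  isFan : IsFan F'
  refines : Refines F' F
  simplicial : ∀ C ∈ F', C.IsSimplicial

/-- The dimension of a cone: the dimension of its linear span. -/
def coneDim {E : Type*} [AddCommGroup E] [Module ℝ E] (C : PointedCone ℝ E) : ℕ :=
  Module.finrank ℝ (Submodule.span ℝ (C : Set E))

/-- The maximal cones of a fan: the cones of maximal dimension. -/
def maximalCones {E : Type*} [AddCommGroup E] [Module ℝ E] (F : Set (PointedCone ℝ E)) :
    Set (PointedCone ℝ E) :=
  {C | C ∈ F ∧ ∀ D ∈ F, coneDim D ≤ coneDim C}

/-- The discrete σ-algebra on the set of maximal cones. -/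
instance {E : Type*} [AddCommGroup E] [Module ℝ E] (F : Set (PointedCone ℝ E)) :
    MeasurableSpace (maximalCones F) := ⊤

/-! ### The positive projective simplex and its canonical form -/

/-- The quotient σ-algebra on real projective space, from `ℝⁿ ∖ {0} → ℙⁿ⁻¹`. -/
instance (n : ℕ) : MeasurableSpace (Projectivization ℝ (Fin n → ℝ)) :=
  MeasurableSpace.map (Projectivization.mk' ℝ) inferInstance

/-- The positive projective simplex: points `[x_1 : … : x_n]` with all `x_k > 0`, `n = m + 1`. -/
abbrev PosProj (m : ℕ) : Type :=
  {p : Projectivization ℝ (Fin (m + 1) → ℝ) //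
    ∃ (v : Fin (m + 1) → ℝ) (hv : v ≠ 0), (∀ k, 0 < v k) ∧ Projectivization.mk ℝ v hv = p}

lemma ne_zero_of_pos {m : ℕ} {x : Fin (m + 1) → ℝ} (h : ∀ k, 0 < x k) : x ≠ 0 := by
  rintro rfl
  exact lt_irrefl _ (h 0)

open Classical in
/-- The point `[x_1 : … : x_n]` of the positive projective simplex for a vector with positive
entries (and `[1 : … : 1]` for all other vectors, which is never relevant). -/
def toPosProj {m : ℕ} (x : Fin (m + 1) → ℝ) : PosProj m :=
  if h : ∀ k, 0 < x k then ⟨Projectivization.mk ℝ x (ne_zero_of_pos h), x, _, h, rfl⟩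
  else ⟨Projectivization.mk ℝ 1 one_ne_zero, 1, one_ne_zero, fun _ => one_pos, rfl⟩

lemma measurable_toPosProj (m : ℕ) : Measurable (toPosProj (m := m)) := by
  classical
  have hs : MeasurableSet {x : Fin (m + 1) → ℝ | ∀ k, 0 < x k} := by
    have : {x : Fin (m + 1) → ℝ | ∀ k, 0 < x k} = ⋂ k, {x | 0 < x k} := by ext; simp
    rw [this]
    exact MeasurableSet.iInter fun k => measurableSet_lt measurable_const (measurable_pi_apply k)
  have hmk : Measurable (Projectivization.mk' ℝ (V := Fin (m + 1) → ℝ)) := fun _ h => h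
  have hite : Measurable fun x : Fin (m + 1) → ℝ => if ∀ k, 0 < x k then x else 1 :=
    Measurable.ite hs measurable_id measurable_const
  have hne : ∀ x : Fin (m + 1) → ℝ, (if ∀ k, 0 < x k then x else 1) ≠ 0 := by
    intro x
    split_ifs with h
    exacts [ne_zero_of_pos h, one_ne_zero]
  have key : (fun x : Fin (m + 1) → ℝ => (toPosProj x).1) =
      fun x => Projectivization.mk' ℝ ⟨if ∀ k, 0 < x k then x else 1, hne x⟩ := by
    funext x
    by_cases h : ∀ k, 0 < x k <;> simp [toPosProj, h, Projectivization.mk'_eq_mk]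
  have hval : Measurable fun x : Fin (m + 1) → ℝ => (toPosProj x).1 := by
    rw [key]
    exact hmk.comp (hite.subtype_mk)
  exact hval.subtype_mk

/-- A representative with positive entries of a point of the positive projective simplex. -/
def posRep {m : ℕ} (p : PosProj m) : Fin (m + 1) → ℝ := p.2.choose

lemma posRep_pos {m : ℕ} (p : PosProj m) (k : Fin (m + 1)) : 0 < posRep p k :=
  p.2.choose_spec.choose_spec.1 k

lemma toPosProj_posRep {m : ℕ} (p : PosProj m) : toPosProj (posRep p) = p := by
  apply Subtype.ext
  rw [toPosProj, dif_pos (posRep_pos p)]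
  exact p.2.choose_spec.choose_spec.2

/-- The differential form
`Ω = ∑ k, (-1)^(n-k) dx_1/x_1 ∧ … ∧ (omit dx_k/x_k) ∧ … ∧ dx_n/x_n`, `n = m + 1`, at the point `x`,
evaluated on the tangent vectors `v 0, …, v (m-1)`.  (The index `k` starts at `0` here.) -/
def canonicalForm {m : ℕ} (x : Fin (m + 1) → ℝ) (v : Fin m → Fin (m + 1) → ℝ) : ℝ :=
  ∑ k : Fin (m + 1), (-1) ^ (m - (k : ℕ)) *
    Matrix.det (Matrix.of fun i j : Fin m => v i (k.succAbove j) / x (k.succAbove j))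

/-- The affine chart `(t_1, …, t_{n-1}) ↦ (t_1, …, t_{n-1}, 1)`. -/
def chart {m : ℕ} (t : Fin m → ℝ) : Fin (m + 1) → ℝ := Fin.snoc (α := fun _ => ℝ) t 1

/-- The pullback of `Ω` to the chart, as a density with respect to Lebesgue measure: `Ω` on the
partial derivatives of the chart, which are the first `n - 1` standard basis vectors. -/
def canonicalDensity {m : ℕ} (t : Fin m → ℝ) : ℝ :=
  canonicalForm (chart t) fun i => Pi.single i.castSucc 1

lemma canonicalDensity_eq {m : ℕ} (t : Fin m → ℝ) : canonicalDensity t = ∏ k, (t k)⁻¹ := by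
  unfold canonicalDensity canonicalForm
  rw [Fin.sum_univ_castSucc, Finset.sum_eq_zero, zero_add]
  · have : (Matrix.of fun i j : Fin m =>
        (Pi.single i.castSucc 1 : Fin (m + 1) → ℝ) ((Fin.last m).succAbove j) /
          chart t ((Fin.last m).succAbove j)) = Matrix.diagonal fun k => (t k)⁻¹ := by
      ext i j
      rcases eq_or_ne i j with rfl | h
      · simp [chart]
      · simp [chart, h, h.symm]
    rw [this, Matrix.det_diagonal]
    simp
  · intro k _
    have hk : k.castSucc ≠ Fin.last m := (Fin.castSucc_lt_last k).ne
    obtain ⟨j, hj⟩ := Fin.exists_succAbove_eq hk.symm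
    rw [Matrix.det_eq_zero_of_column_eq_zero j, mul_zero]
    intro i
    simp [hj]

/-- The measure on the positive projective simplex given by integration against `Ω`, that is, the
integral over `ℝ_{>0}^{n-1}` of the pullback of `Ω` to the affine chart `x_n = 1`. -/
def canonicalMeasure (m : ℕ) : Measure (PosProj m) :=
  ((volume.restrict {t : Fin m → ℝ | ∀ k, 0 < t k}).withDensity
    fun t => ENNReal.ofReal (canonicalDensity t)).map fun t => toPosProj (chart t)

/-- The component-wise exponential of a cone in `ℝⁿ / 𝟙ℝ`. -/
def expCone {m : ℕ} (C : PointedCone ℝ (TropSpace m)) : Set (PosProj m) :=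
  {p | ∃ y : Fin (m + 1) → ℝ, toTrop m y ∈ C ∧ p = toPosProj fun k => Real.exp (y k)}

/-! ### The tropical integral, the tropical measure and the sampling map -/

section Integral

variable {m : ℕ} {ι κ : Type*} [Fintype ι] [Fintype κ]
  (a : ι → MvPolynomial (Fin (m + 1)) ℂ) (b : κ → MvPolynomial (Fin (m + 1)) ℂ)
  (ν : ι → ℂ) (ρ : κ → ℂ)

/-- The tropical integrand as a function on the positive projective simplex (its value does not
depend on the representative when the integrand is homogeneous of degree `0`). -/
def tropFun (p : PosProj m) : ℝ := tropIntegrand a b ν ρ (posRep p)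

/-- The tropical integral `I^tr`. -/
def tropIntegral : ℝ := ∫ p, tropFun a b ν ρ p ∂(canonicalMeasure m)

/-- The tropical measure `μ^tr = (1 / I^tr) (∏ a_i^tr(x)^{Re ν_i} / ∏ b_j^tr(x)^{Re ρ_j}) Ω`. -/
def tropMeasure : Measure (PosProj m) :=
  (canonicalMeasure m).withDensity
    fun p => ENNReal.ofReal (1 / tropIntegral a b ν ρ * tropFun a b ν ρ p)

end Integral

/-- The weight `|det(u_1, …, u_{n-1}, 𝟙)| / ∏ k, ⟨u_k, w⟩` of a simplicial cone. -/
def coneWeight {m : ℕ} (u : Fin m → Fin (m + 1) → ℝ) (w : Fin (m + 1) → ℝ) : ℝ :=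
  |Matrix.det (Matrix.of (Fin.snoc (α := fun _ => Fin (m + 1) → ℝ) u 1))| / ∏ k, u k ⬝ᵥ w

/-- The map `ξ ↦ [x_1 : … : x_n]`, `x_k = ∏ i, ξ_i ^ (-u_{i,k} / ⟨u_i, w⟩)`. -/
def samplePoint {m : ℕ} (u : Fin m → Fin (m + 1) → ℝ) (w : Fin (m + 1) → ℝ) (ξ : Fin m → ℝ) :
    PosProj m :=
  toPosProj fun k => ∏ i, ξ i ^ (-u i k / (u i ⬝ᵥ w))

end TropicalSampling

end

/-! In logarithmic coordinates `x = exp y` the tropical integrand is the exponential of `h_A y - h_B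
y`, a difference of support functions, and `Ω` is Lebesgue measure on `ℝⁿ / 𝟙ℝ`. On a cone `C` of
the refinement both support functions are linear, so the integrand is `exp (-⟨y, w⟩)`
(`tropIntegrand_exp`). Writing `y = ∑ s_i u_i` separates the variables, and `ξ_i = exp (-s_i ⟨u_i,
w⟩)` turns each exponential factor into the uniform density on `(0,1)`; the constant left over is
the cone weight (`setLIntegral_image_sampleChart`).

The substitution requires `⟨u_i, w⟩ > 0`. This is where the relative interior enters: a functional
that is not constant on `B` is strictly smaller on `A` than its maximum over `B`
(`dotProduct_sub_pos`).

The maximal cones tile the space up to a null set. Normal fans are complete and finitely many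
lower-dimensional cones are negligible (`ae_exists_mem_image_sampleChart`), while the face condition
of a fan makes the open cones disjoint (`pairwise_disjoint_image_sampleChart`).

Summing over cones gives one identity for integrals against an arbitrary nonnegative measurable `g`
(`lintegral_mul_eq_sum`). The choice `g = 1` yields convergence and the value of the integral;
general `g` identifies the law of the sample. -/

noncomputable section

namespace TropicalSampling

/-! ### Scale invariance -/

lemma toPosProj_eq_of_smul {m : ℕ} {x y : Fin (m + 1) → ℝ} (hx : ∀ k, 0 < x k)
    (hy : ∀ k, 0 < y k) {c : ℝ} (h : c • y = x) : toPosProj x = toPosProj y := by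
  apply Subtype.ext
  rw [toPosProj, toPosProj, dif_pos hx, dif_pos hy]
  exact (Projectivization.mk_eq_mk_iff' ℝ x y _ _).2 ⟨c, h⟩

lemma exists_smul_of_toPosProj_eq {m : ℕ} {x y : Fin (m + 1) → ℝ} (hx : ∀ k, 0 < x k)
    (hy : ∀ k, 0 < y k) (h : toPosProj x = toPosProj y) : ∃ c : ℝ, 0 < c ∧ c • y = x := by
  have h' := congrArg Subtype.val h
  rw [toPosProj, toPosProj, dif_pos hx, dif_pos hy] at h'
  obtain ⟨c, hc⟩ := (Projectivization.mk_eq_mk_iff' ℝ x y _ _).1 h'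
  refine ⟨c, ?_, hc⟩
  have h0 := hx 0
  rw [← hc, Pi.smul_apply, smul_eq_mul] at h0
  exact pos_of_mul_pos_left h0 (hy 0).le

/-- The affine coordinates `x_k / x_n` of a point of the positive projective simplex. -/
def affineCoord {m : ℕ} (p : PosProj m) : Fin m → ℝ :=
  fun k => p.1.rep k.castSucc / p.1.rep (Fin.last m)

/-- For the quotient σ-algebra, measurability is tested after composing with `Projectivization.mk'`,
where the arbitrary scalar in `rep` cancels from the ratio. -/
lemma measurable_affineCoord (m : ℕ) : Measurable (affineCoord (m := m)) := by
  have h : Measurable fun (p : Projectivization ℝ (Fin (m + 1) → ℝ)) (k : Fin m) =>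
      p.rep k.castSucc / p.rep (Fin.last m) := by
    have key : ((fun (p : Projectivization ℝ (Fin (m + 1) → ℝ)) (k : Fin m) =>
        p.rep k.castSucc / p.rep (Fin.last m)) ∘ Projectivization.mk' ℝ) =
        fun v => fun k => v.1 k.castSucc / v.1 (Fin.last m) := by
      funext v k
      obtain ⟨c, hc⟩ := Projectivization.exists_smul_eq_mk_rep ℝ v.1 v.2
      simp only [Function.comp, Projectivization.mk'_eq_mk, ← hc, Pi.smul_apply]
      rw [Units.smul_def, Units.smul_def, smul_eq_mul, smul_eq_mul, mul_div_mul_left _ _ c.ne_zero]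
    have : Measurable ((fun (p : Projectivization ℝ (Fin (m + 1) → ℝ)) (k : Fin m) =>
        p.rep k.castSucc / p.rep (Fin.last m)) ∘ Projectivization.mk' ℝ) := by
      rw [key]
      refine measurable_pi_lambda _ fun k => ?_
      exact ((measurable_pi_apply _).comp measurable_subtype_coe).div
        ((measurable_pi_apply _).comp measurable_subtype_coe)
    exact fun s hs => this hs
  exact h.comp measurable_subtype_coe

lemma affineCoord_toPosProj {m : ℕ} {x : Fin (m + 1) → ℝ} (hx : ∀ k, 0 < x k) (k : Fin m) :
    affineCoord (toPosProj x) k = x k.castSucc / x (Fin.last m) := by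
  rw [affineCoord, toPosProj, dif_pos hx]
  obtain ⟨c, hc⟩ := Projectivization.exists_smul_eq_mk_rep ℝ x (ne_zero_of_pos hx)
  simp only [← hc, Pi.smul_apply]
  rw [Units.smul_def, Units.smul_def, smul_eq_mul, smul_eq_mul, mul_div_mul_left _ _ c.ne_zero]

lemma chart_pos {m : ℕ} {t : Fin m → ℝ} (ht : ∀ k, 0 < t k) (k : Fin (m + 1)) :
    0 < chart t k := by
  refine Fin.lastCases ?_ (fun k => ?_) k
  · simp [chart]
  · simpa [chart] using ht k

lemma measurable_chart (m : ℕ) : Measurable (chart (m := m)) := by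
  refine measurable_pi_lambda _ fun k => ?_
  refine Fin.lastCases ?_ (fun k => ?_) k
  · simp only [chart, Fin.snoc_last]
    exact measurable_const
  · simp only [chart, Fin.snoc_castSucc]
    exact measurable_pi_apply k

lemma toPosProj_eq_chart {m : ℕ} {x : Fin (m + 1) → ℝ} (hx : ∀ k, 0 < x k) :
    toPosProj x = toPosProj (chart fun k => x k.castSucc / x (Fin.last m)) := by
  refine toPosProj_eq_of_smul hx (chart_pos fun k => div_pos (hx _) (hx _))
    (c := x (Fin.last m)) ?_
  have := (hx (Fin.last m)).ne'
  funext k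
  refine Fin.lastCases ?_ (fun k => ?_) k
  · simp [chart]
  · simp [chart]
    field_simp

lemma toPosProj_chart_affineCoord {m : ℕ} (p : PosProj m) :
    toPosProj (chart (affineCoord p)) = p := by
  have h : affineCoord p =
      fun k => posRep p k.castSucc / posRep p (Fin.last m) := by
    funext k
    conv_lhs => rw [← toPosProj_posRep p]
    exact affineCoord_toPosProj (posRep_pos p) k
  rw [h, ← toPosProj_eq_chart (posRep_pos p), toPosProj_posRep]

lemma affineCoord_pos {m : ℕ} (p : PosProj m) (k : Fin m) : 0 < affineCoord p k := by
  conv_rhs => rw [← toPosProj_posRep p]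
  rw [affineCoord_toPosProj (posRep_pos p)]
  exact div_pos (posRep_pos p _) (posRep_pos p _)

/-! ### Tropical evaluation -/

/-- The support function of the support of `p`. -/
def supportFun {n : ℕ} (p : MvPolynomial (Fin n) ℂ) (y : Fin n → ℝ) : ℝ :=
  ⨆ l : p.support, y ⬝ᵥ exponentVec (l : Fin n →₀ ℕ)

lemma prod_exp_pow {n : ℕ} (y : Fin n → ℝ) (l : Fin n →₀ ℕ) :
    ∏ k, Real.exp (y k) ^ l k = Real.exp (y ⬝ᵥ exponentVec l) := by
  rw [dotProduct, Real.exp_sum]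
  refine Finset.prod_congr rfl fun k _ => ?_
  rw [← Real.exp_nat_mul, exponentVec, mul_comm]

lemma tropApprox_exp {n : ℕ} {p : MvPolynomial (Fin n) ℂ} (hp : p ≠ 0) (y : Fin n → ℝ) :
    tropApprox p (fun k => Real.exp (y k)) = Real.exp (supportFun p y) := by
  -- An empty supremum is `0`, which `exp` would not preserve.
  have : Nonempty p.support := by
    obtain ⟨l, hl⟩ := MvPolynomial.support_nonempty.2 hp
    exact ⟨⟨l, hl⟩⟩
  rw [tropApprox, supportFun, Real.exp_monotone.map_ciSup_of_continuousAt
    Real.continuous_exp.continuousAt (Set.finite_range _).bddAbove]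
  simp only [prod_exp_pow]

lemma le_supportFun {n : ℕ} {p : MvPolynomial (Fin n) ℂ} (y : Fin n → ℝ) {v : Fin n → ℝ}
    (hv : v ∈ newtonPolytope p) : y ⬝ᵥ v ≤ supportFun p y := by
  have hc : Convex ℝ {v : Fin n → ℝ | y ⬝ᵥ v ≤ supportFun p y} := by
    intro v hv w hw s t hs ht hst
    simp only [Set.mem_ofPred_eq, dotProduct_add, dotProduct_smul, smul_eq_mul] at *
    calc s * y ⬝ᵥ v + t * y ⬝ᵥ w ≤ s * supportFun p y + t * supportFun p y :=
          add_le_add (mul_le_mul_of_nonneg_left hv hs) (mul_le_mul_of_nonneg_left hw ht)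
      _ = supportFun p y := by rw [← add_mul, hst, one_mul]
  refine convexHull_min ?_ hc hv
  rintro _ ⟨l, hl, rfl⟩
  exact le_ciSup (f := fun l : p.support => y ⬝ᵥ exponentVec (l : Fin n →₀ ℕ))
    (Set.finite_range _).bddAbove ⟨l, hl⟩

lemma exists_eq_supportFun {n : ℕ} {p : MvPolynomial (Fin n) ℂ} (hp : p ≠ 0) (y : Fin n → ℝ) :
    ∃ l ∈ p.support, y ⬝ᵥ exponentVec l = supportFun p y := by
  have : Nonempty p.support := by
    obtain ⟨l, hl⟩ := MvPolynomial.support_nonempty.2 hp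
    exact ⟨⟨l, hl⟩⟩
  obtain ⟨l, hl⟩ := exists_eq_ciSup_of_finite
    (f := fun l : p.support => y ⬝ᵥ exponentVec (l : Fin n →₀ ℕ))
  exact ⟨l, l.2, hl⟩

/-! ### Support functions of weighted Minkowski sums -/

section Weighted

variable {n : ℕ} {ι : Type*} [Fintype ι] {p : ι → MvPolynomial (Fin n) ℂ} {ν : ι → ℂ}

/-- Support functions are additive under Minkowski sums and homogeneous under nonnegative scaling:
maximizing over the sum amounts to maximizing in each summand separately. -/
lemma dotProduct_eq_of_isMaxOn (hp : ∀ i, p i ≠ 0) (hν : ∀ i, 0 ≤ (ν i).re) {v y : Fin n → ℝ}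
    (hv : v ∈ weightedPolytope p ν)
    (hmax : IsMaxOn (fun w => y ⬝ᵥ w) (weightedPolytope p ν) v) :
    y ⬝ᵥ v = ∑ i, (ν i).re * supportFun (p i) y := by
  apply le_antisymm
  · obtain ⟨g, hg, rfl⟩ := (Set.mem_fintype_sum _ _).1 hv
    rw [dotProduct_sum]
    refine Finset.sum_le_sum fun i _ => ?_
    obtain ⟨z, hz, hzi⟩ := Set.mem_smul_set.1 (hg i)
    rw [← hzi, dotProduct_smul, smul_eq_mul]
    exact mul_le_mul_of_nonneg_left (le_supportFun y hz) (hν i)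
  · choose l hl hly using fun i => exists_eq_supportFun (hp i) y
    have : ∑ i, (ν i).re • exponentVec (l i) ∈ weightedPolytope p ν :=
      (Set.mem_fintype_sum _ _).2 ⟨_, fun i => Set.smul_mem_smul_set
        (subset_convexHull ℝ _ (Set.mem_image_of_mem _ (hl i))), rfl⟩
    have h := hmax this
    simpa only [Set.mem_ofPred_eq, dotProduct_sum, dotProduct_smul, smul_eq_mul, hly] using h

lemma prod_tropApprox_exp (hp : ∀ i, p i ≠ 0) (y : Fin n → ℝ) :
    ∏ i, tropApprox (p i) (fun k => Real.exp (y k)) ^ (ν i).re =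
      Real.exp (∑ i, (ν i).re * supportFun (p i) y) := by
  rw [Real.exp_sum]
  refine Finset.prod_congr rfl fun i _ => ?_
  rw [tropApprox_exp (hp i), ← Real.exp_mul, mul_comm]

lemma isCompact_weightedPolytope : IsCompact (weightedPolytope p ν) := by
  unfold weightedPolytope
  refine Finset.sum_induction _ IsCompact (fun _ _ h h' => h.add h') isCompact_singleton
    fun i _ => ?_
  exact ((Set.toFinite _).image _ |>.isCompact_convexHull ℝ).smul _

lemma weightedPolytope_nonempty (hp : ∀ i, p i ≠ 0) : (weightedPolytope p ν).Nonempty := by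
  choose l hl using fun i => MvPolynomial.support_nonempty.2 (hp i)
  exact ⟨∑ i, (ν i).re • exponentVec (l i), (Set.mem_fintype_sum _ _).2
    ⟨_, fun i => Set.smul_mem_smul_set
        (subset_convexHull ℝ _ (Set.mem_image_of_mem _ (hl i))), rfl⟩⟩

/-- Homogeneity puts each Newton polytope in a hyperplane of constant coordinate sum. -/
lemma one_dotProduct_weightedPolytope (hh : ∀ i, (p i).IsHomogeneous (p i).totalDegree)
    {v : Fin n → ℝ} (hv : v ∈ weightedPolytope p ν) :
    1 ⬝ᵥ v = ∑ i, (ν i).re * (p i).totalDegree := by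
  obtain ⟨g, hg, rfl⟩ := (Set.mem_fintype_sum _ _).1 hv
  rw [dotProduct_sum]
  refine Finset.sum_congr rfl fun i _ => ?_
  obtain ⟨z, hz, hzi⟩ := Set.mem_smul_set.1 (hg i)
  rw [← hzi, dotProduct_smul, smul_eq_mul]
  congr 1
  have hc : Convex ℝ {v : Fin n → ℝ | 1 ⬝ᵥ v = ((p i).totalDegree : ℝ)} := by
    intro v hv w hw s t hs ht hst
    simp only [Set.mem_ofPred_eq, dotProduct_add, dotProduct_smul, smul_eq_mul] at *
    rw [hv, hw, ← add_mul, hst, one_mul]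
  refine convexHull_min ?_ hc hz
  rintro _ ⟨l, hl, rfl⟩
  have := hh i (MvPolynomial.mem_support_iff.1 hl)
  rw [Finsupp.weight_apply, Finsupp.sum_fintype _ _ (by simp)] at this
  simp only [Set.mem_ofPred_eq, one_dotProduct, exponentVec, ← this]
  push_cast
  simp

end Weighted

/-! ### The tropical integrand: piecewise log-linearity, degree zero, measurability -/

section Integrand

variable {m : ℕ} {ι κ : Type*} [Fintype ι] [Fintype κ]
  {a : ι → MvPolynomial (Fin (m + 1)) ℂ} {b : κ → MvPolynomial (Fin (m + 1)) ℂ}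
  {ν : ι → ℂ} {ρ : κ → ℂ}

lemma tropIntegrand_exp (ha0 : ∀ i, a i ≠ 0) (hb0 : ∀ j, b j ≠ 0) (hν : ∀ i, 0 ≤ (ν i).re)
    (hρ : ∀ j, 0 ≤ (ρ j).re) {y vA vB : Fin (m + 1) → ℝ}
    (hvA : vA ∈ weightedPolytope a ν)
    (hA : IsMaxOn (fun v => y ⬝ᵥ v) (weightedPolytope a ν) vA)
    (hvB : vB ∈ weightedPolytope b ρ)
    (hB : IsMaxOn (fun v => y ⬝ᵥ v) (weightedPolytope b ρ) vB) :
    tropIntegrand a b ν ρ (fun k => Real.exp (y k)) = Real.exp (-(y ⬝ᵥ (vB - vA))) := by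
  rw [tropIntegrand, prod_tropApprox_exp ha0, prod_tropApprox_exp hb0, ← Real.exp_sub,
    dotProduct_sub, dotProduct_eq_of_isMaxOn ha0 hν hvA hA, dotProduct_eq_of_isMaxOn hb0 hρ hvB hB,
    neg_sub]

lemma exists_isMaxOn_weightedPolytope (ha0 : ∀ i, a i ≠ 0) (y : Fin (m + 1) → ℝ) :
    ∃ v ∈ weightedPolytope a ν, IsMaxOn (fun v => y ⬝ᵥ v) (weightedPolytope a ν) v :=
  isCompact_weightedPolytope.exists_isMaxOn (weightedPolytope_nonempty ha0)
    (Continuous.dotProduct continuous_const continuous_id).continuousOn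

lemma isMaxOn_add_smul_one (hh : ∀ i, (a i).IsHomogeneous (a i).totalDegree)
    {y v : Fin (m + 1) → ℝ} (hv : v ∈ weightedPolytope a ν)
    (hmax : IsMaxOn (fun v => y ⬝ᵥ v) (weightedPolytope a ν) v) (s : ℝ) :
    IsMaxOn (fun v => (y + s • 1) ⬝ᵥ v) (weightedPolytope a ν) v := by
  intro v' hv'
  have := hmax hv'
  simp only [Set.mem_ofPred_eq, add_dotProduct, smul_dotProduct,
    one_dotProduct_weightedPolytope hh hv, one_dotProduct_weightedPolytope hh hv'] at this ⊢
  linarith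

lemma sum_re_mul_degree_eq
    (hdeg : ∑ i, ν i * ((a i).totalDegree : ℂ) = ∑ j, ρ j * ((b j).totalDegree : ℂ)) :
    ∑ i, (ν i).re * ((a i).totalDegree : ℝ) = ∑ j, (ρ j).re * ((b j).totalDegree : ℝ) := by
  simpa using congrArg Complex.re hdeg

lemma tropIntegrand_smul (ha0 : ∀ i, a i ≠ 0) (hb0 : ∀ j, b j ≠ 0)
    (ha : ∀ i, (a i).IsHomogeneous (a i).totalDegree)
    (hb : ∀ j, (b j).IsHomogeneous (b j).totalDegree)
    (hν : ∀ i, 0 ≤ (ν i).re) (hρ : ∀ j, 0 ≤ (ρ j).re)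
    (hdeg : ∑ i, ν i * ((a i).totalDegree : ℂ) = ∑ j, ρ j * ((b j).totalDegree : ℂ))
    {x : Fin (m + 1) → ℝ} (hx : ∀ k, 0 < x k) {c : ℝ} (hc : 0 < c) :
    tropIntegrand a b ν ρ (c • x) = tropIntegrand a b ν ρ x := by
  set y : Fin (m + 1) → ℝ := fun k => Real.log (x k)
  have hxy : x = fun k => Real.exp (y k) := by
    funext k
    exact (Real.exp_log (hx k)).symm
  have hcy : c • x = fun k => Real.exp ((y + Real.log c • 1) k) := by
    funext k
    simp only [Pi.add_apply, Pi.smul_apply, Pi.one_apply, smul_eq_mul, mul_one, Real.exp_add,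
      Real.exp_log hc, y, Real.exp_log (hx k), mul_comm (x k)]
  obtain ⟨vA, hvA, hA⟩ := exists_isMaxOn_weightedPolytope (ν := ν) ha0 y
  obtain ⟨vB, hvB, hB⟩ := exists_isMaxOn_weightedPolytope (ν := ρ) hb0 y
  rw [hcy, tropIntegrand_exp ha0 hb0 hν hρ hvA (isMaxOn_add_smul_one ha hvA hA _) hvB
    (isMaxOn_add_smul_one hb hvB hB _), hxy, tropIntegrand_exp ha0 hb0 hν hρ hvA hA hvB hB,
    add_dotProduct, smul_dotProduct, dotProduct_sub 1, one_dotProduct_weightedPolytope ha hvA,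
    one_dotProduct_weightedPolytope hb hvB, sum_re_mul_degree_eq hdeg]
  simp

lemma tropFun_toPosProj (ha0 : ∀ i, a i ≠ 0) (hb0 : ∀ j, b j ≠ 0)
    (ha : ∀ i, (a i).IsHomogeneous (a i).totalDegree)
    (hb : ∀ j, (b j).IsHomogeneous (b j).totalDegree)
    (hν : ∀ i, 0 ≤ (ν i).re) (hρ : ∀ j, 0 ≤ (ρ j).re)
    (hdeg : ∑ i, ν i * ((a i).totalDegree : ℂ) = ∑ j, ρ j * ((b j).totalDegree : ℂ))
    {x : Fin (m + 1) → ℝ} (hx : ∀ k, 0 < x k) :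
    tropFun a b ν ρ (toPosProj x) = tropIntegrand a b ν ρ x := by
  obtain ⟨c, hc, h⟩ := exists_smul_of_toPosProj_eq (posRep_pos (toPosProj x)) hx
    (toPosProj_posRep _)
  rw [tropFun, ← h, tropIntegrand_smul ha0 hb0 ha hb hν hρ hdeg hx hc]

lemma measurable_tropApprox {n : ℕ} (p : MvPolynomial (Fin n) ℂ) : Measurable (tropApprox p) := by
  unfold tropApprox
  exact Measurable.iSup fun l => by fun_prop

lemma measurable_tropIntegrand : Measurable (tropIntegrand a b ν ρ) := by
  unfold tropIntegrand
  exact (Finset.measurable_fun_prod _ fun i _ => (measurable_tropApprox _).pow_const _).div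
    (Finset.measurable_fun_prod _ fun j _ => (measurable_tropApprox _).pow_const _)

/-- `posRep` is an arbitrary choice, so the function is first rewritten through the measurable
section `chart ∘ affineCoord`, which scale invariance permits. -/
lemma measurable_tropFun (ha0 : ∀ i, a i ≠ 0) (hb0 : ∀ j, b j ≠ 0)
    (ha : ∀ i, (a i).IsHomogeneous (a i).totalDegree)
    (hb : ∀ j, (b j).IsHomogeneous (b j).totalDegree)
    (hν : ∀ i, 0 ≤ (ν i).re) (hρ : ∀ j, 0 ≤ (ρ j).re)
    (hdeg : ∑ i, ν i * ((a i).totalDegree : ℂ) = ∑ j, ρ j * ((b j).totalDegree : ℂ)) :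
    Measurable (tropFun a b ν ρ) := by
  have h : tropFun a b ν ρ = fun p => tropIntegrand a b ν ρ (chart (affineCoord p)) := by
    funext p
    rw [← tropFun_toPosProj ha0 hb0 ha hb hν hρ hdeg (chart_pos (affineCoord_pos p)),
      toPosProj_chart_affineCoord]
  rw [h]
  exact measurable_tropIntegrand.comp ((measurable_chart m).comp (measurable_affineCoord m))

lemma tropApprox_nonneg {n : ℕ} (p : MvPolynomial (Fin n) ℂ) {x : Fin n → ℝ}
    (hx : ∀ k, 0 < x k) : 0 ≤ tropApprox p x :=
  Real.iSup_nonneg fun _ => Finset.prod_nonneg fun k _ => pow_nonneg (hx k).le _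

lemma tropFun_nonneg (p : PosProj m) : 0 ≤ tropFun a b ν ρ p :=
  div_nonneg
    (Finset.prod_nonneg fun _ _ => Real.rpow_nonneg (tropApprox_nonneg _ (posRep_pos p)) _)
    (Finset.prod_nonneg fun _ _ => Real.rpow_nonneg (tropApprox_nonneg _ (posRep_pos p)) _)

end Integrand

/-! ### Strict positivity on cones -/

/-- The segment from `v` to `x` can be prolonged slightly beyond `x` inside `B`. If `y` were smaller
at `v` than at `x`, it would exceed its maximum on the prolongation. -/
lemma dotProduct_eq_of_mem_intrinsicInterior {n : ℕ} {B : Set (Fin n → ℝ)} {x y v : Fin n → ℝ}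
    (hx : x ∈ intrinsicInterior ℝ B) (hmax : ∀ w ∈ B, y ⬝ᵥ w ≤ y ⬝ᵥ x) (hv : v ∈ B) :
    y ⬝ᵥ v = y ⬝ᵥ x := by
  refine le_antisymm (hmax v hv) ?_
  obtain ⟨x', hx', rfl⟩ := mem_intrinsicInterior.1 hx
  let g : ℝ → affineSpan ℝ B := fun ε =>
    ⟨AffineMap.lineMap (x' : Fin n → ℝ) v ε,
      AffineMap.lineMap_mem ε x'.2 (subset_affineSpan ℝ B hv)⟩
  have hg : Continuous g := AffineMap.lineMap_continuous.subtype_mk _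
  have h0 : g 0 = x' := Subtype.ext (AffineMap.lineMap_apply_zero _ _)
  have hev : ∀ᶠ ε in nhds (0 : ℝ), g ε ∈ interior (Subtype.val ⁻¹' B : Set (affineSpan ℝ B)) :=
    hg.continuousAt.eventually_mem (by rw [h0]; exact isOpen_interior.mem_nhds hx')
  -- A negative parameter lies beyond `x`, on the side away from `v`.
  obtain ⟨ε, hε, hεlt⟩ :=
    ((hev.filter_mono nhdsWithin_le_nhds).and (self_mem_nhdsWithin (s := Set.Iio (0 : ℝ)))).exists
  have hmem : g ε ∈ (Subtype.val ⁻¹' B : Set (affineSpan ℝ B)) := interior_subset hε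
  have h := hmax _ hmem
  simp only [g, AffineMap.lineMap_apply_module', dotProduct_add, dotProduct_smul, dotProduct_sub,
    smul_eq_mul] at h
  have hlt : ε < 0 := hεlt
  nlinarith

/-- By dimension count the directions of `B` fill the hyperplane orthogonal to `𝟙`. So `y` vanishes
on every `e_k - e_0`, that is, all its coordinates agree. -/
lemma mem_span_one_of_dotProduct_const {m : ℕ} {B : Set (Fin (m + 1) → ℝ)}
    (hB : Module.finrank ℝ (vectorSpan ℝ B) = m) {c d : ℝ} {y : Fin (m + 1) → ℝ}
    (h1 : ∀ v ∈ B, 1 ⬝ᵥ v = c) (hy : ∀ v ∈ B, y ⬝ᵥ v = d) :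
    y ∈ Submodule.span ℝ {(1 : Fin (m + 1) → ℝ)} := by
  let φ : (Fin (m + 1) → ℝ) → Module.Dual ℝ (Fin (m + 1) → ℝ) := fun z =>
    dotProductBilin ℝ ℝ z
  have hle : ∀ (z : Fin (m + 1) → ℝ) (e : ℝ), (∀ v ∈ B, z ⬝ᵥ v = e) →
      vectorSpan ℝ B ≤ LinearMap.ker (φ z) := by
    intro z e hz
    refine Submodule.span_le.2 ?_
    rintro _ ⟨v, hv, w, hw, rfl⟩
    simp [φ, hz v hv, hz w hw]
  have hne : φ 1 ≠ 0 := fun h => by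
    have := LinearMap.congr_fun h (Pi.single 0 1)
    simp [φ] at this
  have hker : Module.finrank ℝ (LinearMap.ker (φ 1)) = m := by
    have := Module.Dual.finrank_ker_add_one_of_ne_zero hne
    simpa using this
  have heq := Submodule.eq_of_le_of_finrank_eq (hle 1 c h1) (hB.trans hker.symm)
  have hyk := hle y d hy
  rw [heq] at hyk
  refine Submodule.mem_span_singleton.2 ⟨y 0, ?_⟩
  funext k
  have hmem : (Pi.single k 1 - Pi.single 0 1 : Fin (m + 1) → ℝ) ∈ LinearMap.ker (φ 1) := by
    simp [φ]
  have := hyk hmem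
  simp only [LinearMap.mem_ker, φ, dotProductBilin_apply_apply, dotProduct_sub,
    dotProduct_single, mul_one] at this
  simp only [Pi.smul_apply, Pi.one_apply, smul_eq_mul, mul_one]
  linarith

lemma toTrop_eq_zero_iff {m : ℕ} {y : Fin (m + 1) → ℝ} :
    toTrop m y = 0 ↔ y ∈ Submodule.span ℝ {(1 : Fin (m + 1) → ℝ)} := by
  simp [toTrop]

/-- A functional that is not a multiple of `𝟙` is strictly larger on its maximizers over `B` than
on points in the relative interior of `B`. -/
lemma dotProduct_sub_pos {m : ℕ} {B : Set (Fin (m + 1) → ℝ)}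
    (hB : Module.finrank ℝ (vectorSpan ℝ B) = m) {c : ℝ} (h1 : ∀ v ∈ B, 1 ⬝ᵥ v = c)
    {y x v : Fin (m + 1) → ℝ} (hx : x ∈ intrinsicInterior ℝ B)
    (hmax : IsMaxOn (fun v => y ⬝ᵥ v) B v) (hy : toTrop m y ≠ 0) :
    0 < y ⬝ᵥ (v - x) := by
  rw [dotProduct_sub, sub_pos]
  have hle : y ⬝ᵥ x ≤ y ⬝ᵥ v := hmax (intrinsicInterior_subset hx)
  refine lt_of_le_of_ne hle fun heq => hy (toTrop_eq_zero_iff.2 ?_)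
  exact mem_span_one_of_dotProduct_const hB h1 (d := y ⬝ᵥ x) fun w hw =>
    dotProduct_eq_of_mem_intrinsicInterior hx
      (fun w' hw' => (hmax hw').trans heq.ge) hw

/-! ### Completeness of fans -/

/-- The required face is the set of maximizers of `y` itself. -/
lemma exists_mem_normalFan {n : ℕ} {P : Set (Fin n → ℝ)} (hP : IsCompact P) (hne : P.Nonempty)
    (y : Fin n → ℝ) : ∃ C ∈ normalFan P, y ∈ C := by
  obtain ⟨v, hv, hmax⟩ := hP.exists_isMaxOn hne
    (f := fun v => y ⬝ᵥ v) (Continuous.dotProduct continuous_const continuous_id).continuousOn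
  let Fy : Set (Fin n → ℝ) := {x | x ∈ P ∧ ∀ w ∈ P, y ⬝ᵥ w ≤ y ⬝ᵥ x}
  refine ⟨normalCone P Fy, ⟨Fy, ⟨v, hv, fun w hw => hmax hw⟩, fun _ =>
    ⟨∑ k, y k • ContinuousLinearMap.proj k, ?_⟩, rfl⟩, fun v hv w hw => hv.2 w hw⟩
  ext x
  simp [Fy, dotProduct]

lemma exists_mem_of_refines {m : ℕ} {A B : Set (Fin (m + 1) → ℝ)} (hA : IsCompact A)
    (hA0 : A.Nonempty) (hB : IsCompact B) (hB0 : B.Nonempty)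
    {F : Set (PointedCone ℝ (TropSpace m))} (hF : Refines F (reducedCommonFan A B))
    (z : TropSpace m) : ∃ D ∈ F, z ∈ D := by
  obtain ⟨y, rfl⟩ := Submodule.mkQ_surjective _ z
  obtain ⟨C₁, h₁, hy₁⟩ := exists_mem_normalFan hA hA0 y
  obtain ⟨C₂, h₂, hy₂⟩ := exists_mem_normalFan hB hB0 y
  obtain ⟨S, hS, hU⟩ := hF _ ⟨C₁ ⊓ C₂, ⟨C₁, h₁, C₂, h₂, rfl⟩, rfl⟩
  have hmem : toTrop m y ∈ (PointedCone.map (toTrop m) (C₁ ⊓ C₂) : Set (TropSpace m)) :=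
    PointedCone.mem_map.2 ⟨y, ⟨hy₁, hy₂⟩, rfl⟩
  rw [hU] at hmem
  obtain ⟨D, hD, hyD⟩ := Set.mem_iUnion₂.1 hmem
  exact ⟨D, hS hD, hyD⟩

lemma finrank_tropSpace (m : ℕ) : Module.finrank ℝ (TropSpace m) = m := by
  have h := Submodule.finrank_quotient_add_finrank
    (Submodule.span ℝ {(1 : Fin (m + 1) → ℝ)})
  rw [finrank_span_singleton one_ne_zero, Module.finrank_fin_fun] at h
  exact Nat.succ_injective h

/-! ### Full-dimensional cones and faces in a complete finite family -/

section Fan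

variable {E : Type*} [AddCommGroup E] [Module ℝ E] {F : Set (PointedCone ℝ E)}

/-- A real vector space is not a finite union of proper subspaces. -/
lemma exists_span_eq_top (hfin : F.Finite) (hcov : ∀ z, ∃ D ∈ F, z ∈ D) :
    ∃ D ∈ F, Submodule.span ℝ (D : Set E) = ⊤ := by
  by_contra! h
  let s : Finset (Submodule ℝ E) :=
    (hfin.image fun D : PointedCone ℝ E => Submodule.span ℝ (D : Set E)).toFinset
  have hs : ⊤ ∉ s := by
    simp only [s, Set.Finite.mem_toFinset, Set.mem_image, not_exists, not_and]
    exact h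
  refine Subspace.biUnion_ne_univ_of_top_notMem hs (Set.eq_univ_of_forall fun z => ?_)
  obtain ⟨D, hD, hz⟩ := hcov z
  refine Set.mem_iUnion₂.2 ⟨Submodule.span ℝ (D : Set E), ?_, Submodule.subset_span hz⟩
  simp only [s, Set.Finite.mem_toFinset]
  exact ⟨D, hD, rfl⟩

lemma mem_maximalCones_iff [FiniteDimensional ℝ E] (hfin : F.Finite)
    (hcov : ∀ z, ∃ D ∈ F, z ∈ D) {C : PointedCone ℝ E} :
    C ∈ maximalCones F ↔ C ∈ F ∧ Submodule.span ℝ (C : Set E) = ⊤ := by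
  obtain ⟨D, hD, hDtop⟩ := exists_span_eq_top hfin hcov
  constructor
  · rintro ⟨hC, hmax⟩
    refine ⟨hC, Submodule.eq_top_of_finrank_eq (le_antisymm (Submodule.finrank_le _) ?_)⟩
    have := hmax D hD
    rwa [coneDim, hDtop, finrank_top] at this
  · rintro ⟨hC, htop⟩
    refine ⟨hC, fun D' _ => ?_⟩
    rw [coneDim, coneDim, htop, finrank_top]
    exact Submodule.finrank_le _

lemma mem_hull_range_iff {ι : Type*} [Fintype ι] {f : ι → E} {z : E} :
    z ∈ PointedCone.hull ℝ (Set.range f) ↔ ∃ c : ι → ℝ, (∀ i, 0 ≤ c i) ∧ ∑ i, c i • f i = z := by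
  rw [Submodule.mem_span_range_iff_exists_fun]
  constructor
  · rintro ⟨c, hc⟩
    exact ⟨fun i => c i, fun i => (c i).2, hc⟩
  · rintro ⟨c, hc, h⟩
    exact ⟨fun i => ⟨c i, hc i⟩, h⟩

lemma span_hull (s : Set E) :
    Submodule.span ℝ (PointedCone.hull ℝ s : Set E) = Submodule.span ℝ s :=
  le_antisymm (Submodule.span_le.2 (PointedCone.hull_le_span ℝ s))
    (Submodule.span_mono PointedCone.subset_hull)

/-- A point with all coefficients positive is interior to `C` relative to its span. A face
containing it contains every generator, because a face contains the summands of its elements. -/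
lemma le_of_pos_combination_mem {ι : Type*} [Fintype ι] {C D : PointedCone ℝ E} {f : ι → E}
    (hC : PointedCone.hull ℝ (Set.range f) = C) (hface : (C ⊓ D).IsFaceOf C) {c : ι → ℝ}
    (hc : ∀ i, 0 < c i) (hD : ∑ i, c i • f i ∈ D) : C ≤ D := by
  classical
  rw [← hC, Submodule.span_le]
  rintro _ ⟨i, rfl⟩
  have hf : ∀ j, f j ∈ C := fun j => by
    rw [← hC]
    exact PointedCone.subset_hull ⟨j, rfl⟩
  have hs : ∀ s : Finset ι, ∑ j ∈ s, c j • f j ∈ C := fun s =>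
    Submodule.sum_mem _ fun j _ => C.smul_mem (hc j).le (hf j)
  refine (hface.mem_of_smul_add_mem (hf i) (hs (Finset.univ.erase i)) (hc i) ?_).2
  rw [Finset.add_sum_erase _ (fun j => c j • f j) (Finset.mem_univ i)]
  exact ⟨hs _, hD⟩

end Fan

/-! ### The linear chart of `ℝⁿ / 𝟙ℝ` -/

/-- The linear chart `x ↦ (x, 0) + 𝟙ℝ`. -/
def tropChart (m : ℕ) : (Fin m → ℝ) →ₗ[ℝ] TropSpace m where
  toFun x := toTrop m (Fin.snoc (α := fun _ => ℝ) x 0)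
  map_add' x y := by
    rw [← map_add]
    congr 1
    funext k
    refine Fin.lastCases ?_ (fun k => ?_) k <;> simp
  map_smul' c x := by
    rw [← map_smul]
    congr 1
    funext k
    refine Fin.lastCases ?_ (fun k => ?_) k <;> simp

lemma tropChart_sub_last {m : ℕ} (y : Fin (m + 1) → ℝ) :
    tropChart m (fun k => y k.castSucc - y (Fin.last m)) = toTrop m y := by
  refine (Submodule.Quotient.eq _).2 (Submodule.mem_span_singleton.2 ⟨-y (Fin.last m), ?_⟩)
  funext k
  refine Fin.lastCases ?_ (fun k => ?_) k <;> simp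

lemma tropChart_surjective (m : ℕ) : Function.Surjective (tropChart m) := fun z => by
  obtain ⟨y, rfl⟩ := Submodule.mkQ_surjective _ z
  exact ⟨_, tropChart_sub_last y⟩

lemma tropChart_injective (m : ℕ) : Function.Injective (tropChart m) :=
  (LinearMap.injective_iff_surjective_of_finrank_eq_finrank
    (by rw [finrank_tropSpace, Module.finrank_fin_fun])).2 (tropChart_surjective m)

/-! ### The matrix of a simplicial cone -/

section ConeMatrix

variable {m : ℕ} {u : Fin m → Fin (m + 1) → ℝ}

/-- The matrix of generators of a cone in the linear chart. -/
def coneMatrix (u : Fin m → Fin (m + 1) → ℝ) : Matrix (Fin m) (Fin m) ℝ :=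
  Matrix.of fun k i => u i k.castSucc - u i (Fin.last m)

lemma tropChart_coneMatrix_mulVec (s : Fin m → ℝ) :
    tropChart m ((coneMatrix u).mulVec s) = ∑ i, s i • toTrop m (u i) := by
  simp_rw [← tropChart_sub_last, ← map_smul, ← map_sum]
  congr 1
  funext k
  simp [Matrix.mulVec, dotProduct, coneMatrix, mul_comm]

/-- After transposing, the last row is subtracted from the others; the column coming from `𝟙`
becomes the last unit vector, and expansion along it leaves `coneMatrix u`. -/
lemma det_snoc_one (u : Fin m → Fin (m + 1) → ℝ) :
    Matrix.det (Matrix.of (Fin.snoc (α := fun _ => Fin (m + 1) → ℝ) u 1)) =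
      (coneMatrix u).det := by
  set M := Matrix.of (Fin.snoc (α := fun _ => Fin (m + 1) → ℝ) u 1)
  let N : Matrix (Fin (m + 1)) (Fin (m + 1)) ℝ := Matrix.of fun k i =>
    M i k - (if k = Fin.last m then 0 else 1) * M i (Fin.last m)
  have hMN : M.transpose.det = N.det := by
    refine Matrix.det_eq_of_forall_row_eq_smul_add_const
      (fun k => if k = Fin.last m then 0 else 1) (Fin.last m) (by simp) fun k i => ?_
    simp [N]
  rw [← Matrix.det_transpose, hMN, Matrix.det_succ_column N (Fin.last m),
    Fin.sum_univ_castSucc, Finset.sum_eq_zero, zero_add]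
  · have hsub : N.submatrix (Fin.last m).succAbove (Fin.last m).succAbove = coneMatrix u := by
      ext k i
      simp [N, M, coneMatrix, (Fin.castSucc_lt_last k).ne]
    rw [hsub]
    simp [N, M, ← two_mul]
  · intro k _
    simp [N, M, (Fin.castSucc_lt_last k).ne]

lemma det_coneMatrix_ne_zero (hu : LinearIndependent ℝ fun i => toTrop m (u i)) :
    (coneMatrix u).det ≠ 0 := by
  intro h
  obtain ⟨s, hs, h0⟩ := Matrix.exists_mulVec_eq_zero_iff.2 h
  refine hs (funext fun i => Fintype.linearIndependent_iff.1 hu s ?_ i)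
  rw [← tropChart_coneMatrix_mulVec, h0, map_zero]

end ConeMatrix

/-! ### The sampling map in the affine chart -/

/-- The open unit cube. -/
abbrev openCube (m : ℕ) : Set (Fin m → ℝ) := Set.univ.pi fun _ => Set.Ioo 0 1

lemma measurableSet_openCube (m : ℕ) : MeasurableSet (openCube m) :=
  MeasurableSet.univ_pi fun _ => measurableSet_Ioo

section SampleChart

variable {m : ℕ} {u : Fin m → Fin (m + 1) → ℝ} {w : Fin (m + 1) → ℝ}

/-- The affine coordinates of `samplePoint u w ξ`. -/
def sampleChart (u : Fin m → Fin (m + 1) → ℝ) (w : Fin (m + 1) → ℝ) (ξ : Fin m → ℝ) :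
    Fin m → ℝ :=
  fun k => Real.exp ((coneMatrix u).mulVec (fun i => -Real.log (ξ i) / (u i ⬝ᵥ w)) k)

lemma sampleChart_pos (ξ : Fin m → ℝ) (k : Fin m) : 0 < sampleChart u w ξ k := Real.exp_pos _

/-- The logarithm of `samplePoint u w ξ`. -/
def sampleVec (u : Fin m → Fin (m + 1) → ℝ) (w : Fin (m + 1) → ℝ) (ξ : Fin m → ℝ) :
    Fin (m + 1) → ℝ :=
  ∑ i, (-Real.log (ξ i) / (u i ⬝ᵥ w)) • u i

lemma samplePoint_eq_exp {ξ : Fin m → ℝ} (hξ : ∀ i, 0 < ξ i) :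
    samplePoint u w ξ = toPosProj fun k => Real.exp (sampleVec u w ξ k) := by
  rw [samplePoint]
  congr 1
  funext k
  rw [sampleVec, Finset.sum_apply, Real.exp_sum]
  refine Finset.prod_congr rfl fun i _ => ?_
  rw [Real.rpow_def_of_pos (hξ i), Pi.smul_apply, smul_eq_mul]
  congr 1
  ring

lemma samplePoint_eq_chart {ξ : Fin m → ℝ} (hξ : ∀ i, 0 < ξ i) :
    samplePoint u w ξ = toPosProj (chart (sampleChart u w ξ)) := by
  rw [samplePoint_eq_exp hξ, toPosProj_eq_chart fun k => Real.exp_pos _]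
  congr 2
  funext k
  rw [← Real.exp_sub, sampleChart]
  congr 1
  simp only [sampleVec, Finset.sum_apply, Pi.smul_apply, smul_eq_mul, ← Finset.sum_sub_distrib,
    Matrix.mulVec, dotProduct, coneMatrix, Matrix.of_apply]
  exact Finset.sum_congr rfl fun i _ => by ring

lemma toTrop_sampleVec (ξ : Fin m → ℝ) :
    toTrop m (sampleVec u w ξ) = ∑ i, (-Real.log (ξ i) / (u i ⬝ᵥ w)) • toTrop m (u i) := by
  simp only [sampleVec, map_sum, map_smul]

lemma sampleVec_dotProduct (hc : ∀ i, 0 < u i ⬝ᵥ w) (ξ : Fin m → ℝ) :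
    sampleVec u w ξ ⬝ᵥ w = ∑ i, -Real.log (ξ i) := by
  rw [sampleVec, sum_dotProduct]
  refine Finset.sum_congr rfl fun i _ => ?_
  rw [smul_dotProduct, smul_eq_mul, div_mul_cancel₀ _ (hc i).ne']

lemma tropChart_log_sampleChart (ξ : Fin m → ℝ) :
    tropChart m (fun k => Real.log (sampleChart u w ξ k)) =
      ∑ i, (-Real.log (ξ i) / (u i ⬝ᵥ w)) • toTrop m (u i) := by
  rw [← tropChart_coneMatrix_mulVec]
  congr 1
  funext k
  rw [sampleChart, Real.log_exp]

/-- Under `ξ_i = exp (-s_i ⟨u_i, w⟩)`, the condition `0 < ξ_i < 1` means `s_i > 0`. The image of the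
open cube is thus the exponential of the open cone. -/
lemma mem_image_sampleChart_iff (hc : ∀ i, 0 < u i ⬝ᵥ w) {t : Fin m → ℝ} :
    t ∈ sampleChart u w '' openCube m ↔ (∀ k, 0 < t k) ∧ ∃ s : Fin m → ℝ, (∀ i, 0 < s i) ∧
      ∑ i, s i • toTrop m (u i) = tropChart m (fun k => Real.log (t k)) := by
  constructor
  · rintro ⟨ξ, hξ, rfl⟩
    refine ⟨sampleChart_pos ξ, _, fun i => ?_, (tropChart_log_sampleChart ξ).symm⟩
    have := hξ i trivial
    exact div_pos (neg_pos.2 (Real.log_neg this.1 this.2)) (hc i)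
  · rintro ⟨ht, s, hs, h⟩
    refine ⟨fun i => Real.exp (-(s i * (u i ⬝ᵥ w))), fun i _ => ⟨Real.exp_pos _, ?_⟩, ?_⟩
    · rw [Real.exp_lt_one_iff, neg_lt_zero]
      exact mul_pos (hs i) (hc i)
    · have hinj : (fun k => Real.log (sampleChart u w
          (fun i => Real.exp (-(s i * (u i ⬝ᵥ w)))) k)) = fun k => Real.log (t k) := by
        apply tropChart_injective m
        rw [tropChart_log_sampleChart, ← h]
        refine Finset.sum_congr rfl fun i _ => ?_
        rw [Real.log_exp, neg_neg, mul_div_cancel_right₀ _ (hc i).ne']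
      funext k
      exact Real.log_injOn_pos (sampleChart_pos _ k) (ht k) (congrFun hinj k)

lemma injOn_sampleChart (hc : ∀ i, 0 < u i ⬝ᵥ w) (hdet : (coneMatrix u).det ≠ 0) :
    Set.InjOn (sampleChart u w) (openCube m) := by
  intro ξ hξ η hη h
  have h1 : (coneMatrix u).mulVec (fun i => -Real.log (ξ i) / (u i ⬝ᵥ w)) =
      (coneMatrix u).mulVec (fun i => -Real.log (η i) / (u i ⬝ᵥ w)) := by
    funext k
    exact Real.exp_injective (congrFun h k)
  have h2 := Matrix.mulVec_injective_of_isUnit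
    ((Matrix.isUnit_iff_isUnit_det _).2 (isUnit_iff_ne_zero.2 hdet)) h1
  funext i
  have h3 := (div_left_inj' (hc i).ne').1 (congrFun h2 i)
  exact Real.log_injOn_pos (hξ i trivial).1 (hη i trivial).1 (neg_injective h3)

/-- The Jacobian matrix of `sampleChart u w`. -/
def sampleJacobian (u : Fin m → Fin (m + 1) → ℝ) (w : Fin (m + 1) → ℝ) (ξ : Fin m → ℝ) :
    Matrix (Fin m) (Fin m) ℝ :=
  Matrix.diagonal (sampleChart u w ξ) * coneMatrix u *
    Matrix.diagonal fun i => -(ξ i)⁻¹ / (u i ⬝ᵥ w)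

/-- Chain rule for the composite of coordinatewise logarithms, a linear map and coordinatewise
exponentials. -/
lemma hasFDerivAt_sampleChart {ξ : Fin m → ℝ} (hξ : ∀ i, 0 < ξ i) :
    HasFDerivAt (sampleChart u w)
      (LinearMap.toContinuousLinearMap (Matrix.toLin' (sampleJacobian u w ξ))) ξ := by
  rw [hasFDerivAt_pi']
  intro k
  have h1 : ∀ i : Fin m, HasFDerivAt
      (fun η : Fin m → ℝ => coneMatrix u k i * (-Real.log (η i) / (u i ⬝ᵥ w)))
      ((coneMatrix u k i * (-(ξ i)⁻¹ / (u i ⬝ᵥ w))) •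
        (ContinuousLinearMap.proj i : (Fin m → ℝ) →L[ℝ] ℝ)) ξ := fun i =>
    (((Real.hasDerivAt_log (hξ i).ne').neg.div_const _).const_mul _).comp_hasFDerivAt
      (f := fun η : Fin m → ℝ => η i) ξ (hasFDerivAt_apply i ξ)
  have h2 := (HasFDerivAt.fun_sum fun i (_ : i ∈ Finset.univ) => h1 i).exp
  refine h2.congr_fderiv ?_
  ext v
  simp [sampleJacobian, Matrix.mulVec, dotProduct, Matrix.mul_diagonal, Matrix.diagonal_mul,
    sampleChart, Finset.mul_sum, mul_assoc]

lemma abs_det_sampleJacobian (hc : ∀ i, 0 < u i ⬝ᵥ w) {ξ : Fin m → ℝ} (hξ : ∀ i, 0 < ξ i) :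
    |(sampleJacobian u w ξ).det| =
      coneWeight u w * (∏ k, sampleChart u w ξ k) * ∏ i, (ξ i)⁻¹ := by
  rw [sampleJacobian, Matrix.det_mul, Matrix.det_mul, Matrix.det_diagonal, Matrix.det_diagonal,
    abs_mul, abs_mul, Finset.abs_prod, Finset.abs_prod, coneWeight, det_snoc_one]
  have h1 : ∏ i, |-(ξ i)⁻¹ / (u i ⬝ᵥ w)| = (∏ i, (ξ i)⁻¹) / ∏ i, u i ⬝ᵥ w := by
    rw [← Finset.prod_div_distrib]
    refine Finset.prod_congr rfl fun i _ => ?_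
    rw [abs_div, abs_neg, abs_of_pos (inv_pos.2 (hξ i)), abs_of_pos (hc i)]
  have h2 : ∏ k, |sampleChart u w ξ k| = ∏ k, sampleChart u w ξ k :=
    Finset.prod_congr rfl fun k _ => abs_of_pos (sampleChart_pos ξ k)
  rw [h1, h2]
  ring

lemma coneWeight_pos (hc : ∀ i, 0 < u i ⬝ᵥ w) (hdet : (coneMatrix u).det ≠ 0) :
    0 < coneWeight u w := by
  rw [coneWeight, det_snoc_one]
  exact div_pos (abs_pos.2 hdet) (Finset.prod_pos fun i _ => hc i)

lemma measurableSet_image_sampleChart (hc : ∀ i, 0 < u i ⬝ᵥ w)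
    (hdet : (coneMatrix u).det ≠ 0) : MeasurableSet (sampleChart u w '' openCube m) :=
  measurable_image_of_fderivWithin (measurableSet_openCube m)
    (fun _ hξ => (hasFDerivAt_sampleChart fun i => (hξ i trivial).1).hasFDerivWithinAt)
    (injOn_sampleChart hc hdet)

/-- In the change of variables the Jacobian is `coneWeight` times `∏ x_k / ∏ ξ_i`. The density of
`Ω` cancels `∏ x_k` and the integrand cancels `∏ ξ_i`, leaving a constant. -/
lemma setLIntegral_image_sampleChart (hc : ∀ i, 0 < u i ⬝ᵥ w) (hdet : (coneMatrix u).det ≠ 0)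
    {f : PosProj m → ℝ}
    (hf : ∀ ξ ∈ openCube m, f (samplePoint u w ξ) = ∏ i, ξ i) (g : PosProj m → ENNReal) :
    ∫⁻ t in sampleChart u w '' openCube m, ENNReal.ofReal (canonicalDensity t) *
        (ENNReal.ofReal (f (toPosProj (chart t))) * g (toPosProj (chart t))) =
      ∫⁻ ξ in openCube m, ENNReal.ofReal (coneWeight u w) * g (samplePoint u w ξ) := by
  rw [lintegral_image_eq_lintegral_abs_det_fderiv_mul volume (measurableSet_openCube m)
    (fun _ hξ => (hasFDerivAt_sampleChart fun i => (hξ i trivial).1).hasFDerivWithinAt)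
    (injOn_sampleChart hc hdet)]
  refine setLIntegral_congr_fun (measurableSet_openCube m) fun ξ hξ => ?_
  have hpos : ∀ i, 0 < ξ i := fun i => (hξ i trivial).1
  have hw := coneWeight_pos hc hdet
  have hprod : 0 < ∏ i, ξ i := Finset.prod_pos fun i _ => hpos i
  have hprod' : 0 < ∏ k, sampleChart u w ξ k := Finset.prod_pos fun k _ => sampleChart_pos ξ k
  have hdet' : (LinearMap.toContinuousLinearMap (Matrix.toLin' (sampleJacobian u w ξ))).det =
      (sampleJacobian u w ξ).det := by
    rw [ContinuousLinearMap.det, LinearMap.coe_toContinuousLinearMap, LinearMap.det_toLin']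
  rw [hdet', ← samplePoint_eq_chart hpos, hf ξ hξ, abs_det_sampleJacobian hc hpos,
    canonicalDensity_eq, Finset.prod_inv_distrib, Finset.prod_inv_distrib]
  generalize ∏ i, ξ i = X at hprod ⊢
  generalize ∏ k, sampleChart u w ξ k = Y at hprod' ⊢
  rw [← mul_assoc, ← mul_assoc, ← ENNReal.ofReal_mul (by positivity),
    ← ENNReal.ofReal_mul (by positivity)]
  congr 2
  field_simp

lemma toTrop_sampleVec_mem (hc : ∀ i, 0 < u i ⬝ᵥ w) {C : PointedCone ℝ (TropSpace m)}
    (hu : ∀ i, toTrop m (u i) ∈ C) {ξ : Fin m → ℝ} (hξ : ξ ∈ openCube m) :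
    toTrop m (sampleVec u w ξ) ∈ C := by
  rw [toTrop_sampleVec]
  refine Submodule.sum_mem _ fun i _ => C.smul_mem ?_ (hu i)
  have := hξ i trivial
  exact (div_pos (neg_pos.2 (Real.log_neg this.1 this.2)) (hc i)).le

lemma samplePoint_mem_expCone (hc : ∀ i, 0 < u i ⬝ᵥ w) {C : PointedCone ℝ (TropSpace m)}
    (hu : ∀ i, toTrop m (u i) ∈ C) {ξ : Fin m → ℝ} (hξ : ξ ∈ openCube m) :
    samplePoint u w ξ ∈ expCone C :=
  ⟨sampleVec u w ξ, toTrop_sampleVec_mem hc hu hξ, samplePoint_eq_exp fun i => (hξ i trivial).1⟩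

lemma measurable_samplePoint (u : Fin m → Fin (m + 1) → ℝ) (w : Fin (m + 1) → ℝ) :
    Measurable (samplePoint u w) := by
  refine (measurable_toPosProj m).comp (measurable_pi_lambda _ fun k => ?_)
  exact Finset.measurable_fun_prod _ fun i _ => (measurable_pi_apply i).pow_const _

end SampleChart

lemma lintegral_canonicalMeasure {m : ℕ} {g : PosProj m → ENNReal} (hg : Measurable g) :
    ∫⁻ p, g p ∂(canonicalMeasure m) = ∫⁻ t in {t : Fin m → ℝ | ∀ k, 0 < t k},
      ENNReal.ofReal (canonicalDensity t) * g (toPosProj (chart t)) := by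
  have hm : Measurable fun t : Fin m → ℝ => toPosProj (chart t) :=
    (measurable_toPosProj m).comp (measurable_chart m)
  have hd : Measurable fun t : Fin m → ℝ => ENNReal.ofReal (canonicalDensity t) := by
    simp_rw [canonicalDensity_eq]
    exact (Finset.measurable_fun_prod _ fun k _ => (measurable_pi_apply k).inv).ennreal_ofReal
  rw [canonicalMeasure, lintegral_map hg hm]
  exact lintegral_withDensity_eq_lintegral_mul _ hd (hg.comp hm)

/-! ### Decomposition of the tropical measure along the cones -/

section Decomposition

variable {m : ℕ} {I : Type*} [Fintype I] {u : I → Fin m → Fin (m + 1) → ℝ}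
  {w : I → Fin (m + 1) → ℝ}

lemma lintegral_mul_eq_sum (hc : ∀ C i, 0 < u C i ⬝ᵥ w C)
    (hdet : ∀ C, (coneMatrix (u C)).det ≠ 0) {f : PosProj m → ℝ} (hfm : Measurable f)
    (hf : ∀ C, ∀ ξ ∈ openCube m, f (samplePoint (u C) (w C) ξ) = ∏ i, ξ i)
    (hdisj : Pairwise (Function.onFun Disjoint fun C => sampleChart (u C) (w C) '' openCube m))
    (hcov : ∀ᵐ t : Fin m → ℝ, (∀ k, 0 < t k) →
      ∃ C, t ∈ sampleChart (u C) (w C) '' openCube m)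
    {g : PosProj m → ENNReal} (hg : Measurable g) :
    ∫⁻ p, ENNReal.ofReal (f p) * g p ∂(canonicalMeasure m) =
      ∑ C, ENNReal.ofReal (coneWeight (u C) (w C)) *
        ∫⁻ ξ in openCube m, g (samplePoint (u C) (w C) ξ) := by
  have hae : {t : Fin m → ℝ | ∀ k, 0 < t k} =ᵐ[volume]
      ⋃ C, sampleChart (u C) (w C) '' openCube m := by
    filter_upwards [hcov] with t ht
    refine propext ⟨fun h => Set.mem_iUnion.2 (ht h), fun h => ?_⟩
    obtain ⟨C, ξ, _, rfl⟩ := Set.mem_iUnion.1 h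
    exact sampleChart_pos ξ
  rw [lintegral_canonicalMeasure (g := fun p => ENNReal.ofReal (f p) * g p) (hfm.ennreal_ofReal.mul hg),
    setLIntegral_congr hae,
    lintegral_iUnion (fun C => measurableSet_image_sampleChart (hc C) (hdet C)) hdisj,
    tsum_fintype]
  refine Finset.sum_congr rfl fun C _ => ?_
  rw [setLIntegral_image_sampleChart (hc C) (hdet C) (hf C),
    lintegral_const_mul (f := fun ξ => g (samplePoint (u C) (w C) ξ)) _
      (hg.comp (measurable_samplePoint _ _))]

end Decomposition

/-! ### The open maximal cones tile the chart up to a null set -/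

section Cover

variable {m : ℕ} {F : Set (PointedCone ℝ (TropSpace m))}
  {u : maximalCones F → Fin m → Fin (m + 1) → ℝ} {w : maximalCones F → Fin (m + 1) → ℝ}

/-- A maximal cone spans the `m`-dimensional space, and `m` spanning vectors are independent there.
-/
lemma linearIndependent_generators (hfin : F.Finite) (hcov : ∀ z, ∃ D ∈ F, z ∈ D)
    {v : Fin m → TropSpace m} {C : maximalCones F}
    (hv : PointedCone.hull ℝ (Set.range v) = C.1) : LinearIndependent ℝ v := by
  have htop := ((mem_maximalCones_iff hfin hcov).1 C.2).2
  rw [← hv, span_hull] at htop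
  exact linearIndependent_of_top_le_span_of_card_eq_finrank htop.ge
    (by rw [finrank_tropSpace, Fintype.card_fin])

lemma volume_preimage_tropChart {S : Submodule ℝ (TropSpace m)} (hS : S ≠ ⊤) :
    volume (tropChart m ⁻¹' (S : Set (TropSpace m))) = 0 := by
  refine Measure.addHaar_submodule volume (S.comap (tropChart m)) fun h => hS ?_
  rw [eq_top_iff]
  rintro z -
  obtain ⟨x, rfl⟩ := tropChart_surjective m z
  have : x ∈ S.comap (tropChart m) := by
    rw [h]
    trivial
  exact this

/-- Almost every point in the chart lies in the exponential of an open maximal cone. -/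
lemma ae_exists_mem_image_sampleChart (hfin : F.Finite) (hcov : ∀ z, ∃ D ∈ F, z ∈ D)
    (hu : ∀ C, PointedCone.hull ℝ (Set.range fun i => toTrop m (u C i)) = C.1)
    (hc : ∀ C i, 0 < u C i ⬝ᵥ w C) :
    ∀ᵐ t : Fin m → ℝ, (∀ k, 0 < t k) →
      ∃ C, t ∈ sampleChart (u C) (w C) '' openCube m := by
  have : Finite (maximalCones F) := (hfin.subset fun C h => h.1).to_subtype
  let lower (C : maximalCones F) (i : Fin m) : Submodule ℝ (TropSpace m) :=
    Submodule.span ℝ ((fun i => toTrop m (u C i)) '' {i}ᶜ)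
  -- The exceptional set in logarithmic coordinates: spans of the lower-dimensional cones, and spans
  -- of the facets of the maximal ones.
  let N : Set (Fin m → ℝ) :=
    (⋃ D ∈ {D | D ∈ F ∧ Submodule.span ℝ (D : Set (TropSpace m)) ≠ ⊤},
      tropChart m ⁻¹' (Submodule.span ℝ (D : Set (TropSpace m)) : Set (TropSpace m))) ∪
    ⋃ C, ⋃ i, tropChart m ⁻¹' (lower C i : Set (TropSpace m))
  have hN : volume N = 0 := by
    refine measure_union_null ?_ (measure_iUnion_null fun C => measure_iUnion_null fun i =>
      volume_preimage_tropChart fun h => ?_)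
    · exact (measure_biUnion_null_iff (hfin.subset fun D h => h.1).countable).2
        fun D hD => volume_preimage_tropChart hD.2
    · have hmem : toTrop m (u C i) ∈ lower C i := by
        rw [h]
        trivial
      exact (linearIndependent_generators hfin hcov (hu C)).notMem_span_image
        (s := {i}ᶜ) (x := i) (by simp) hmem
  -- Differentiable self-maps of `ℝᵐ` preserve null sets, so the exponential image of `N` is null.
  have hdiff : Differentiable ℝ fun (x : Fin m → ℝ) k => Real.exp (x k) := by fun_prop
  have hE := addHaar_image_eq_zero_of_differentiableOn_of_addHaar_eq_zero volume
    hdiff.differentiableOn hN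
  refine (measure_eq_zero_iff_ae_notMem.1 hE).mono fun t ht hpos => ?_
  by_contra! hno
  refine ht ⟨fun k => Real.log (t k), ?_, funext fun k => Real.exp_log (hpos k)⟩
  obtain ⟨D, hD, hz⟩ := hcov (tropChart m fun k => Real.log (t k))
  by_cases htop : Submodule.span ℝ (D : Set (TropSpace m)) = ⊤
  · let C : maximalCones F := ⟨D, (mem_maximalCones_iff hfin hcov).2 ⟨hD, htop⟩⟩
    have hzC : tropChart m (fun k => Real.log (t k)) ∈ C.1 := hz
    rw [← hu C, mem_hull_range_iff] at hzC
    obtain ⟨s, hs, hsum⟩ := hzC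
    by_cases hall : ∀ i, 0 < s i
    · exact absurd ((mem_image_sampleChart_iff (hc C)).2 ⟨hpos, s, hall, hsum⟩) (hno C)
    -- A vanishing coefficient places the point in the span of a facet.
    · push Not at hall
      obtain ⟨i, hi⟩ := hall
      refine Or.inr (Set.mem_iUnion₂.2 ⟨C, i, ?_⟩)
      rw [Set.mem_preimage, ← hsum]
      refine Submodule.sum_mem _ fun j _ => ?_
      by_cases hj : j = i
      · rw [hj, le_antisymm hi (hs i), zero_smul]
        exact Submodule.zero_mem _
      · exact Submodule.smul_mem _ _ (Submodule.subset_span ⟨j, hj, rfl⟩)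
  · exact Or.inl (Set.mem_iUnion₂.2 ⟨D, ⟨hD, htop⟩, Submodule.subset_span hz⟩)

/-- A point common to two open cones forces each closed cone to contain the other. -/
lemma pairwise_disjoint_image_sampleChart
    (hface : ∀ C ∈ F, ∀ D ∈ F, (C ⊓ D).IsFaceOf C ∧ (C ⊓ D).IsFaceOf D)
    (hu : ∀ C, PointedCone.hull ℝ (Set.range fun i => toTrop m (u C i)) = C.1)
    (hc : ∀ C i, 0 < u C i ⬝ᵥ w C) :
    Pairwise (Function.onFun Disjoint fun C => sampleChart (u C) (w C) '' openCube m) := by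
  have key : ∀ (C D : maximalCones F) (t : Fin m → ℝ),
      t ∈ sampleChart (u C) (w C) '' openCube m → t ∈ sampleChart (u D) (w D) '' openCube m →
      C.1 ≤ D.1 := by
    intro C D t hC hD
    obtain ⟨_, s, hs, hsum⟩ := (mem_image_sampleChart_iff (hc C)).1 hC
    obtain ⟨_, s', hs', hsum'⟩ := (mem_image_sampleChart_iff (hc D)).1 hD
    refine le_of_pos_combination_mem (hu C) (hface C.1 C.2.1 D.1 D.2.1).1 hs ?_
    rw [hsum, ← hsum', ← hu D]
    exact mem_hull_range_iff.2 ⟨s', fun i => (hs' i).le, rfl⟩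
  intro C D hCD
  refine Set.disjoint_left.2 fun t hC hD => hCD (Subtype.ext ?_)
  exact le_antisymm (key C D t hC hD) (key D C t hD hC)

end Cover

/-! ### The law of a randomly sampled point -/

lemma volume_openCube (m : ℕ) : volume (openCube m) = 1 := by
  rw [volume_pi_pi]
  simp

lemma map_eq_restrict_openCube {m : ℕ} {Ω : Type*} [MeasurableSpace Ω] {P : Measure Ω}
    {ξ : Ω → Fin m → ℝ} (h : pdf.IsUniform ξ (Set.Icc 0 1) P) :
    AEMeasurable ξ P ∧ P.map ξ = volume.restrict (openCube m) := by
  have hae : openCube m =ᵐ[volume] Set.Icc (0 : Fin m → ℝ) 1 :=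
    Measure.univ_pi_Ioo_ae_eq_Icc (μ := fun _ : Fin m => (volume : Measure ℝ))
      (f := fun _ => 0) (g := fun _ => 1)
  have h1 : volume (Set.Icc (0 : Fin m → ℝ) 1) = 1 := by
    rw [← measure_congr hae, volume_openCube]
  -- Measurability is not assumed: the pushforward under a map that is not a.e. measurable is `0`,
  -- whereas the uniform law on a cube of volume one is not.
  refine ⟨h.aemeasurable (by simp [h1]) (by simp [h1]), ?_⟩
  rw [show P.map ξ = volume[|Set.Icc (0 : Fin m → ℝ) 1] from h, ProbabilityTheory.cond, h1,
    inv_one, one_smul, Measure.restrict_congr_set hae]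

/-- Integration against the law of a sample, when the index and the parameter are independent. -/
lemma lintegral_map_of_indepFun {I X Y Ω : Type*} [Fintype I] [MeasurableSpace I]
    [MeasurableSingletonClass I] [MeasurableSpace X] [MeasurableSpace Y] [MeasurableSpace Ω]
    {P : Measure Ω} [IsProbabilityMeasure P] {μ : Measure X} [SFinite μ] {Φ : I → X → Y}
    (hΦ : ∀ i, Measurable (Φ i)) {c : Ω → I} {ξ : Ω → X} (hc : Measurable c)
    (hξ : AEMeasurable ξ P) (hlaw : P.map ξ = μ) (hind : IndepFun c ξ P) :
    AEMeasurable (fun ω => Φ (c ω) (ξ ω)) P ∧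
    ∀ {g : Y → ENNReal}, Measurable g →
      ∫⁻ y, g y ∂(P.map fun ω => Φ (c ω) (ξ ω)) =
        ∑ i, P (c ⁻¹' {i}) * ∫⁻ x, g (Φ i x) ∂μ := by
  -- Since the index set is finite with measurable singletons, measurability of each slice gives
  -- joint measurability.
  have hΦ' : Measurable fun q : I × X => Φ q.1 q.2 := measurable_from_prod_countable_right hΦ
  have hpair : AEMeasurable (fun ω => (c ω, ξ ω)) P := hc.aemeasurable.prodMk hξ
  have hmeas : AEMeasurable (fun ω => Φ (c ω) (ξ ω)) P := hΦ'.comp_aemeasurable hpair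
  refine ⟨hmeas, fun {g} hg => ?_⟩
  have hg' : Measurable fun q : I × X => g (Φ q.1 q.2) := hg.comp hΦ'
  have hprod := (indepFun_iff_map_prod_eq_prod_map_map hc.aemeasurable hξ).1 hind
  rw [lintegral_map' hg.aemeasurable hmeas,
    ← lintegral_map' (f := fun q : I × X => g (Φ q.1 q.2)) hg'.aemeasurable hpair, hprod, hlaw,
    lintegral_prod _ hg'.aemeasurable, lintegral_fintype]
  refine Finset.sum_congr rfl fun i _ => ?_
  rw [Measure.map_apply hc (measurableSet_singleton i), mul_comm]

/-! ### Total mass and the normalized measure -/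

section Normalization

variable {m : ℕ} {I : Type*} [Fintype I] {u : I → Fin m → Fin (m + 1) → ℝ}
  {w : I → Fin (m + 1) → ℝ} {f : PosProj m → ℝ}

lemma integral_eq_sum_coneWeight (hfm : Measurable f) (hf0 : ∀ p, 0 ≤ f p)
    (hw : ∀ C, 0 ≤ coneWeight (u C) (w C))
    (hdec : ∀ {g : PosProj m → ENNReal}, Measurable g →
      ∫⁻ p, ENNReal.ofReal (f p) * g p ∂(canonicalMeasure m) =
        ∑ C, ENNReal.ofReal (coneWeight (u C) (w C)) *
          ∫⁻ ξ in openCube m, g (samplePoint (u C) (w C) ξ)) :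
    Integrable f (canonicalMeasure m) ∧
      ∫ p, f p ∂(canonicalMeasure m) = ∑ C, coneWeight (u C) (w C) := by
  have h := hdec (g := fun _ => 1) measurable_const
  simp only [lintegral_const, MeasurableSet.univ, Measure.restrict_apply, Set.univ_inter,
    mul_one, volume_openCube] at h
  rw [← ENNReal.ofReal_sum_of_nonneg fun C _ => hw C] at h
  refine ⟨⟨hfm.aestronglyMeasurable, ?_⟩, ?_⟩
  · rw [hasFiniteIntegral_iff_ofReal (Filter.Eventually.of_forall hf0), h]
    exact ENNReal.ofReal_lt_top
  · rw [integral_eq_lintegral_of_nonneg_ae (Filter.Eventually.of_forall hf0)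
      hfm.aestronglyMeasurable, h, ENNReal.toReal_ofReal (Finset.sum_nonneg fun C _ => hw C)]

lemma lintegral_withDensity_normalized (hfm : Measurable f) {c : ℝ} (hc : 0 ≤ c)
    (hdec : ∀ {g : PosProj m → ENNReal}, Measurable g →
      ∫⁻ p, ENNReal.ofReal (f p) * g p ∂(canonicalMeasure m) =
        ∑ C, ENNReal.ofReal (coneWeight (u C) (w C)) *
          ∫⁻ ξ in openCube m, g (samplePoint (u C) (w C) ξ))
    {g : PosProj m → ENNReal} (hg : Measurable g) :
    ∫⁻ p, g p ∂((canonicalMeasure m).withDensity fun p => ENNReal.ofReal (1 / c * f p)) =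
      ∑ C, ENNReal.ofReal (coneWeight (u C) (w C) / c) *
        ∫⁻ ξ in openCube m, g (samplePoint (u C) (w C) ξ) := by
  have hfg : Measurable fun p => ENNReal.ofReal (f p) * g p := hfm.ennreal_ofReal.mul hg
  have h1c : 0 ≤ 1 / c := one_div_nonneg.2 hc
  rw [lintegral_withDensity_eq_lintegral_mul _ (hfm.const_mul (1 / c)).ennreal_ofReal hg]
  have heq : ∀ p, ((fun p => ENNReal.ofReal (1 / c * f p)) * g) p =
      ENNReal.ofReal (1 / c) * (ENNReal.ofReal (f p) * g p) := fun p => by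
    rw [Pi.mul_apply, ENNReal.ofReal_mul h1c, mul_assoc]
  simp_rw [heq]
  rw [lintegral_const_mul _ hfg, hdec hg, Finset.mul_sum]
  refine Finset.sum_congr rfl fun C _ => ?_
  rw [← mul_assoc, ← ENNReal.ofReal_mul h1c, one_div_mul_eq_div]

end Normalization

end TropicalSampling

end

/-! ### Assembly of the theorem -/

theorem mainTheorem7 {m : ℕ} {ι κ : Type*} [Fintype ι] [Fintype κ]
    (a : ι → MvPolynomial (Fin (m + 1)) ℂ) (b : κ → MvPolynomial (Fin (m + 1)) ℂ)
    (ν : ι → ℂ) (ρ : κ → ℂ)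
    (ha0 : ∀ i, a i ≠ 0) (hb0 : ∀ j, b j ≠ 0)
    (ha : ∀ i, (a i).IsHomogeneous (a i).totalDegree)
    (hb : ∀ j, (b j).IsHomogeneous (b j).totalDegree)
    (hν : ∀ i, 0 ≤ (ν i).re) (hρ : ∀ j, 0 ≤ (ρ j).re)
    (hdeg : ∑ i, ν i * ((a i).totalDegree : ℂ) = ∑ j, ρ j * ((b j).totalDegree : ℂ))
    (A B : Set (Fin (m + 1) → ℝ))
    (hA : A = TropicalSampling.weightedPolytope a ν)
    (hB : B = TropicalSampling.weightedPolytope b ρ)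
    (hR1 : Module.finrank ℝ (vectorSpan ℝ B) = m)
    (hR2 : A ⊆ intrinsicInterior ℝ B)
    (F : Set (PointedCone ℝ (TropicalSampling.TropSpace m)))
    (hF : TropicalSampling.IsSimplicialRefinement F (TropicalSampling.reducedCommonFan A B))
    (u : TropicalSampling.maximalCones F → Fin m → Fin (m + 1) → ℝ)
    (hu : ∀ C, PointedCone.hull ℝ (Set.range fun i => TropicalSampling.toTrop m (u C i)) = C.1)
    (wA wB w : TropicalSampling.maximalCones F → Fin (m + 1) → ℝ)
    (hwA : ∀ C, wA C ∈ A ∧ ∀ y, TropicalSampling.toTrop m y ∈ C.1 →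
      IsMaxOn (fun v => y ⬝ᵥ v) A (wA C))
    (hwB : ∀ C, wB C ∈ B ∧ ∀ y, TropicalSampling.toTrop m y ∈ C.1 →
      IsMaxOn (fun v => y ⬝ᵥ v) B (wB C))
    (hw : ∀ C, w C = wB C - wA C) :
    Integrable (TropicalSampling.tropFun a b ν ρ) (TropicalSampling.canonicalMeasure m) ∧
    0 < TropicalSampling.tropIntegral a b ν ρ ∧
    IsProbabilityMeasure (TropicalSampling.tropMeasure a b ν ρ) ∧
    (∀ C, 0 < TropicalSampling.coneWeight (u C) (w C)) ∧
    ∑ᶠ C, TropicalSampling.coneWeight (u C) (w C) = TropicalSampling.tropIntegral a b ν ρ ∧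
    ∀ {Ω : Type*} [MeasurableSpace Ω] (P : Measure Ω) [IsProbabilityMeasure P]
      (cone : Ω → TropicalSampling.maximalCones F) (ξ : Ω → Fin m → ℝ),
      Measurable cone →
      (∀ C, P (cone ⁻¹' {C}) = ENNReal.ofReal
        (TropicalSampling.coneWeight (u C) (w C) / TropicalSampling.tropIntegral a b ν ρ)) →
      pdf.IsUniform ξ (Set.Icc 0 1) P →
      IndepFun cone ξ P →
      (∀ᵐ ω ∂P, TropicalSampling.samplePoint (u (cone ω)) (w (cone ω)) (ξ ω) ∈
        TropicalSampling.expCone (cone ω).1) ∧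
      HasLaw (fun ω => TropicalSampling.samplePoint (u (cone ω)) (w (cone ω)) (ξ ω))
        (TropicalSampling.tropMeasure a b ν ρ) P := by
  have hAc : IsCompact A := hA ▸ TropicalSampling.isCompact_weightedPolytope
  have hBc : IsCompact B := hB ▸ TropicalSampling.isCompact_weightedPolytope
  have hA0 : A.Nonempty := hA ▸ TropicalSampling.weightedPolytope_nonempty ha0
  have hB0 : B.Nonempty := hB ▸ TropicalSampling.weightedPolytope_nonempty hb0
  have hcov := TropicalSampling.exists_mem_of_refines hAc hA0 hBc hB0 hF.refines
  have hfin := hF.isFan.finite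
  have hli : ∀ C, LinearIndependent ℝ fun i => TropicalSampling.toTrop m (u C i) := fun C =>
    TropicalSampling.linearIndependent_generators hfin hcov (hu C)
  have hdet := fun C => TropicalSampling.det_coneMatrix_ne_zero (hli C)
  have huC : ∀ C i, TropicalSampling.toTrop m (u C i) ∈ C.1 := fun C i => by
    rw [← hu C]
    exact PointedCone.subset_hull ⟨i, rfl⟩
  have h1 : ∀ v ∈ B, 1 ⬝ᵥ v = ∑ j, (ρ j).re * ((b j).totalDegree : ℝ) := fun v hv =>
    TropicalSampling.one_dotProduct_weightedPolytope hb (hB ▸ hv)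
  have hc : ∀ C i, 0 < u C i ⬝ᵥ w C := fun C i => by
    rw [hw C]
    exact TropicalSampling.dotProduct_sub_pos hR1 h1 (hR2 (hwA C).1)
      ((hwB C).2 _ (huC C i)) ((hli C).ne_zero i)
  have hpos : ∀ C, 0 < TropicalSampling.coneWeight (u C) (w C) := fun C =>
    TropicalSampling.coneWeight_pos (hc C) (hdet C)
  have hfm := TropicalSampling.measurable_tropFun ha0 hb0 ha hb hν hρ hdeg
  have hf0 := TropicalSampling.tropFun_nonneg (a := a) (b := b) (ν := ν) (ρ := ρ)
  -- The logarithm of a sample from `C` lies in `C`, so `wA C` and `wB C` are maximizers for it, and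
  -- its pairing with `w C` is `-∑ log ξ_i`.
  have hf : ∀ C, ∀ ξ ∈ TropicalSampling.openCube m,
      TropicalSampling.tropFun a b ν ρ (TropicalSampling.samplePoint (u C) (w C) ξ) =
        ∏ i, ξ i := by
    intro C ξ hξ
    have hξ0 : ∀ i, 0 < ξ i := fun i => (hξ i trivial).1
    have hmem := TropicalSampling.toTrop_sampleVec_mem (hc C) (huC C) hξ
    rw [TropicalSampling.samplePoint_eq_exp hξ0,
      TropicalSampling.tropFun_toPosProj ha0 hb0 ha hb hν hρ hdeg fun k => Real.exp_pos _,
      TropicalSampling.tropIntegrand_exp ha0 hb0 hν hρ (hA ▸ (hwA C).1)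
        (hA ▸ (hwA C).2 _ hmem) (hB ▸ (hwB C).1) (hB ▸ (hwB C).2 _ hmem), ← hw C,
      TropicalSampling.sampleVec_dotProduct (hc C), Finset.sum_neg_distrib, neg_neg, Real.exp_sum]
    exact Finset.prod_congr rfl fun i _ => Real.exp_log (hξ0 i)
  have : Finite (TropicalSampling.maximalCones F) := (hfin.subset fun C h => h.1).to_subtype
  have : Fintype (TropicalSampling.maximalCones F) := Fintype.ofFinite _
  have : MeasurableSingletonClass (TropicalSampling.maximalCones F) := ⟨fun _ => trivial⟩
  -- Needed for strict positivity of the sum of the weights.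
  have : Nonempty (TropicalSampling.maximalCones F) := by
    obtain ⟨D, hD⟩ := TropicalSampling.exists_span_eq_top hfin hcov
    exact ⟨⟨D, (TropicalSampling.mem_maximalCones_iff hfin hcov).2 hD⟩⟩
  have hdec := fun {g : TropicalSampling.PosProj m → ENNReal} (hg : Measurable g) =>
    TropicalSampling.lintegral_mul_eq_sum hc hdet hfm hf
      (TropicalSampling.pairwise_disjoint_image_sampleChart hF.isFan.inter_face hu hc)
      (TropicalSampling.ae_exists_mem_image_sampleChart hfin hcov hu hc) hg
  obtain ⟨hint, hI⟩ := TropicalSampling.integral_eq_sum_coneWeight hfm hf0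
    (fun C => (hpos C).le) hdec
  change TropicalSampling.tropIntegral a b ν ρ = _ at hI
  have hIpos : 0 < TropicalSampling.tropIntegral a b ν ρ := by
    rw [hI]
    exact Finset.sum_pos (fun C _ => hpos C) Finset.univ_nonempty
  have hμ := fun {g : TropicalSampling.PosProj m → ENNReal} (hg : Measurable g) =>
    TropicalSampling.lintegral_withDensity_normalized hfm hIpos.le hdec hg
  refine ⟨hint, hIpos, ⟨?_⟩, hpos, ?_, ?_⟩
  · have h := hμ (g := fun _ => 1) measurable_const
    simp only [lintegral_const, MeasurableSet.univ, Measure.restrict_apply, Set.univ_inter,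
      one_mul, mul_one, TropicalSampling.volume_openCube] at h
    rw [← ENNReal.ofReal_sum_of_nonneg fun C _ => (div_pos (hpos C) hIpos).le,
      ← Finset.sum_div, ← hI, div_self hIpos.ne', ENNReal.ofReal_one] at h
    exact h
  · rw [finsum_eq_sum_of_fintype, hI]
  · intro Ω _ P _ cone ξ hcone hP hunif hind
    obtain ⟨hξ, hlaw⟩ := TropicalSampling.map_eq_restrict_openCube hunif
    obtain ⟨hmeas, hmap⟩ := TropicalSampling.lintegral_map_of_indepFun
      (Φ := fun C => TropicalSampling.samplePoint (u C) (w C))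
      (fun C => TropicalSampling.measurable_samplePoint (u C) (w C)) hcone hξ hlaw hind
    refine ⟨?_, hmeas, ?_⟩
    · have hcube : ∀ᵐ x ∂(P.map ξ), x ∈ TropicalSampling.openCube m := by
        rw [hlaw]
        exact ae_restrict_mem (TropicalSampling.measurableSet_openCube m)
      filter_upwards [ae_of_ae_map hξ hcube] with ω hω
      exact TropicalSampling.samplePoint_mem_expCone (hc _) (huC _) hω
    -- Both laws integrate `g` to the same weighted sum over cones, since the cone probabilities are
    -- the normalized weights.
    · refine Measure.ext_of_lintegral _ fun g hg => ?_
      rw [hmap hg]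
      refine Eq.trans ?_ (hμ hg).symm
      exact Finset.sum_congr rfl fun C _ => by rw [hP C]
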